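/- Let $M$ be a compact smooth manifold without boundary, and let $x\in C^\infty(M)$ have $0$ as a regular value, $Z=x^{-1}(0)$. For $m\ge 1$, the $b^m$-tangent bundle ${}^{b^m}TM$ is the vector bundle whose sections are the vector fields $X$ such that $dx(X)$ is divisible by $x^m$; a $b^m$-symplectic form is a smooth section $\omega$ of $\Lambda^2({}^{b^m}T^*M)$ that is closed and has maximal rank at every point of $M$. Its dual $\omega^{-1}$, mapped to $\Lambda^2TM$ by the anchor map, is a bivector field on all of $M$ (the Poisson structure of $\omega$). Let $k\ge 1$ and let $\omega$ be a $b^{2k}$-symplectic form on $(M,Z,x)$, written in Laurent form $$\omega=\frac{dx}{x^{2k}}\wedge\Big(\sum_{i=0}^{2k-1}x^i\alpha_i\Big)+\beta,\qquad \alpha_i=\pi^*\hat\alpha_i,$$ on an open neighborhood $U$ of $Z$ with a smooth retraction $\pi:U\to Z$ (for instance, a tubular neighborhood with its projection), where the $\hat\alpha_i$ are closed smooth $1$-forms on $Z$ and $\beta$ is a smooth $2$-form on $U$. Let $f\in C^\infty(\mathbb R)$ be an odd function with $f'>0$ on $[-1,1]$ and $$f(t)=\frac{-1}{(2k-1)t^{2k-1}}-2\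 \ (t<-1),\qquad f(t)=\frac{-1}{(2k-1)t^{2k-1}}+2\ \ (t>1),$$ and for $\epsilon>0$ put $f_\epsilon(t)=\epsilon^{-(2k-1)}f(t/\epsilon)$. The $f_\epsilon$-desingularization $\omega_\epsilon$ of $\omega$ is defined by $$\omega_\epsilon=d(f_\epsilon\circ x)\wedge\Big(\sum_{i=0}^{2k-1}x^i\alpha_i\Big)+\beta\ \text{ on } U,\qquad \omega_\epsilon=\omega\ \text{ on } M\setminus U.$$ Then: 1. For all sufficiently small $\epsilon>0$, the set $\{|x|\le\epsilon\}$ is contained in $U$ and $\omega_\epsilon$ is a symplectic form on $M$ (smooth, closed and nondegenerate everywhere). 2. For every $\epsilon>0$, $\omega_\epsilon=\omega$ outside the $\epsilon$-neighborhood $\{p\in U:|x(p)|<\epsilon\}$ of $Z$. 3. As $\epsilon\to0^+$, the bivector fields $\omega_\epsilon^{-1}$ converge to the Poisson structure $\omega^{-1}$ in the $C^{2k-1}$ topology on $M$; that is, for all small $\epsilon$ they are of class $C^{2k-1}$, as is $\omega^{-1}$, and in every chart all derivatives of order at most $2k-1$ of their coefficients converge uniformly on compact sets. -/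

import Mathlib

open scoped Manifold ContDiff Topology

noncomputable section

namespace BSymplectic

/-! ### Linear algebra: wedge of covectors, nondegenerate 2-forms and their dual bivectors -/

section LinearAlgebra

theorem update_left {V : Type*} (u v z : V) : Function.update ![u, v] 0 z = ![z, v] := by
  ext i; fin_cases i <;> rfl

theorem update_right {V : Type*} (u v z : V) : Function.update ![u, v] 1 z = ![u, z] := by
  ext i; fin_cases i <;> rfl

variable {V : Type*} [AddCommGroup V] [Module ℝ V] [TopologicalSpace V]

theorem covector_add (a : V [⋀^Fin 1]→L[ℝ] ℝ) (u w : V) : a ![u + w] = a ![u] + a ![w] := by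
  have h := a.map_update_add ![0] 0 u w
  have e : ∀ z : V, Function.update ![(0 : V)] 0 z = ![z] := fun z => by
    ext i; fin_cases i; rfl
  rwa [e, e, e] at h

theorem covector_smul (a : V [⋀^Fin 1]→L[ℝ] ℝ) (c : ℝ) (u : V) : a ![c • u] = c * a ![u] := by
  have h := a.map_update_smul ![0] 0 c u
  have e : ∀ z : V, Function.update ![(0 : V)] 0 z = ![z] := fun z => by
    ext i; fin_cases i; rfl
  rwa [e, e] at h

/-- The wedge product `a ∧ b` of two covectors: `(a ∧ b)(v, w) = a v * b w - a w * b v`. -/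
def wedge (a b : V [⋀^Fin 1]→L[ℝ] ℝ) : V [⋀^Fin 2]→L[ℝ] ℝ where
  toFun v := a ![v 0] * b ![v 1] - a ![v 1] * b ![v 0]
  map_update_add' := by
    intro _ v i u w
    fin_cases i
    · simp [covector_add]; ring
    · simp [covector_add]; ring
  map_update_smul' := by
    intro _ v i c u
    fin_cases i
    · simp [covector_smul]; ring
    · simp [covector_smul]; ring
  map_eq_zero_of_eq' := by
    intro v i j h hij
    fin_cases i <;> fin_cases j <;> simp_all
  cont := by
    have h : ∀ (c : V [⋀^Fin 1]→L[ℝ] ℝ) (i : Fin 2), Continuous fun v : Fin 2 → V => c ![v i] :=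
      fun c i => c.cont.comp (continuous_pi fun _ => by
        simpa using continuous_apply i)
    exact ((h a 0).mul (h b 1)).sub ((h a 1).mul (h b 0))

/-- A 2-form on `V` has maximal rank if `v ↦ Ω(v, ·)` is injective. -/
def Nondegenerate (Ω : V [⋀^Fin 2]→L[ℝ] ℝ) : Prop :=
  ∀ v : V, (∀ w : V, Ω ![v, w] = 0) → v = 0

/-- The map `v ↦ Ω(v, ·)` from `V` to its dual. -/
def flat (Ω : V [⋀^Fin 2]→L[ℝ] ℝ) : V →ₗ[ℝ] Module.Dual ℝ V :=
  LinearMap.mk₂ ℝ (fun v w => Ω ![v, w])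
    (fun u v w => by
      have h := Ω.map_update_add ![0, w] 0 u v
      rwa [update_left, update_left, update_left] at h)
    (fun c v w => by
      have h := Ω.map_update_smul ![0, w] 0 c v
      rwa [update_left, update_left] at h)
    (fun v u w => by
      have h := Ω.map_update_add ![v, 0] 1 u w
      rwa [update_right, update_right, update_right] at h)
    (fun c v w => by
      have h := Ω.map_update_smul ![v, 0] 1 c w
      rwa [update_right, update_right] at h)

open Classical in
/-- The inverse of `v ↦ Ω(v, ·)`, for `Ω` nondegenerate on a finite-dimensional space
(and zero if there is no inverse). -/
def sharp (Ω : V [⋀^Fin 2]→L[ℝ] ℝ) : Module.Dual ℝ V →ₗ[ℝ] V :=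
  if h : Function.Bijective (flat Ω) then
    ((LinearEquiv.ofBijective (flat Ω) h).symm : Module.Dual ℝ V →ₗ[ℝ] V)
  else 0

/-- The bivector `Ω⁻¹` dual to a nondegenerate 2-form `Ω`, as an alternating bilinear form on the
dual of `V`. The sign is the one for which the inverse of `dx ∧ dy` is `∂/∂x ∧ ∂/∂y`. -/
def dualBivector (Ω : V [⋀^Fin 2]→L[ℝ] ℝ) : Module.Dual ℝ V [⋀^Fin 2]→ₗ[ℝ] ℝ :=
  Ω.toAlternatingMap.compLinearMap (sharp Ω)

end LinearAlgebra

/-! ### Differential forms and bivector fields on a manifold without boundary modelled on `E` -/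

section Manifold

variable (E : Type*) [NormedAddCommGroup E] [NormedSpace ℝ E]
variable (F : Type*) [NormedAddCommGroup F] [NormedSpace ℝ F]
variable (M : Type*) [TopologicalSpace M] [ChartedSpace E M]
variable (N : Type*) [TopologicalSpace N] [ChartedSpace F N]

/-- The tangent space of `M` at `p`. -/
abbrev Tan {M : Type*} [TopologicalSpace M] [ChartedSpace E M] (p : M) : Type _ :=
  TangentSpace 𝓘(ℝ, E) p

/-- (Not necessarily continuous) differential forms of degree `k`. -/
abbrev DForm (k : ℕ) : Type _ := ∀ p : M, Tan E p [⋀^Fin k]→L[ℝ] ℝ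

/-- (Not necessarily continuous) bivector fields, a bivector at `p` being an alternating bilinear
form on the cotangent space at `p`. -/
abbrev BivectorField : Type _ := ∀ p : M, Module.Dual ℝ (Tan E p) [⋀^Fin 2]→ₗ[ℝ] ℝ

variable {E F M N}

/-- The differential form `Ω` in the chart `e`: its pullback by `e⁻¹`. Meaningful on `e.target`. -/
def DForm.inChart {k : ℕ} (Ω : DForm E M k) (e : OpenPartialHomeomorph M E) (y : E) :
    E [⋀^Fin k]→L[ℝ] ℝ :=
  (Ω (e.symm y)).compContinuousLinearMap (mfderiv 𝓘(ℝ, E) 𝓘(ℝ, E) e.symm y)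

/-- `Ω` is smooth on the open set `U`. -/
def DForm.SmoothOn {k : ℕ} (Ω : DForm E M k) (U : Set M) : Prop :=
  ∀ e ∈ atlas E M, ContDiffOn ℝ ∞ (Ω.inChart e) (e.target ∩ e.symm ⁻¹' U)

/-- `dΩ = 0` on the open set `U`, for `Ω` smooth on `U`. -/
def DForm.ClosedOn {k : ℕ} (Ω : DForm E M k) (U : Set M) : Prop :=
  ∀ e ∈ atlas E M, ∀ y ∈ e.target ∩ e.symm ⁻¹' U, extDeriv (Ω.inChart e) y = 0

/-- A symplectic form on `M`: a smooth closed 2-form, nondegenerate at every point. -/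
structure IsSymplectic (Ω : DForm E M 2) : Prop where
  smooth : Ω.SmoothOn Set.univ
  closed : Ω.ClosedOn Set.univ
  nondegenerate : ∀ p, Nondegenerate (Ω p)

/-- The differential `dg` of a function at `p`, as a covector. -/
def dAt (g : M → ℝ) (p : M) : Tan E p →L[ℝ] ℝ := mfderiv 𝓘(ℝ, E) 𝓘(ℝ, ℝ) g p

/-- The differential `dg` of a function, as a 1-form. -/
def diff (g : M → ℝ) : DForm E M 1 := fun p =>
  ContinuousAlternatingMap.ofSubsingleton ℝ (Tan E p) ℝ 0 (dAt g p)

/-- The pullback `π^* a` of a differential form. Meaningful where `π` is differentiable. -/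
def DForm.pullback {k : ℕ} (π : M → N) (a : DForm F N k) : DForm E M k := fun p =>
  (a (π p)).compContinuousLinearMap (mfderiv 𝓘(ℝ, E) 𝓘(ℝ, F) π p)

/-- The constant covector `ξ` of the coordinate space of the chart `e`, pulled back to `p`. -/
def chartCovector (e : OpenPartialHomeomorph M E) (ξ : Module.Dual ℝ E) (p : M) :
    Module.Dual ℝ (Tan E p) :=
  ξ.comp (mfderiv 𝓘(ℝ, E) 𝓘(ℝ, E) e p : Tan E p →L[ℝ] E).toLinearMap

/-- The coefficient function of the bivector field `P` in the chart `e` with respect to two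
constant covectors `ξ`, `η` of the coordinate space. Meaningful on `e.target`. -/
def BivectorField.coeff (P : BivectorField E M) (e : OpenPartialHomeomorph M E)
    (ξ η : Module.Dual ℝ E) (y : E) : ℝ :=
  P (e.symm y) ![chartCovector e ξ (e.symm y), chartCovector e η (e.symm y)]

/-- A bivector field of class `C^r`. -/
def BivectorField.IsC (r : ℕ) (P : BivectorField E M) : Prop :=
  ∀ e ∈ atlas E M, ∀ ξ η : Module.Dual ℝ E, ContDiffOn ℝ r (P.coeff e ξ η) e.target

/-- Convergence in the `C^r` topology of the bivector fields `P ε` to `P₀` as `ε → 0⁺`: the fields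
are of class `C^r` and, in every chart, all derivatives of order at most `r` of the coefficients
converge uniformly on compact sets. -/
structure TendstoC (r : ℕ) (P : ℝ → BivectorField E M) (P₀ : BivectorField E M) : Prop where
  isC : ∀ᶠ ε in 𝓝[>] (0 : ℝ), (P ε).IsC r
  isC_lim : P₀.IsC r
  tendsto : ∀ e ∈ atlas E M, ∀ ξ η : Module.Dual ℝ E, ∀ K ⊆ e.target, IsCompact K → ∀ j ≤ r,
    TendstoUniformlyOn (fun ε => iteratedFDeriv ℝ j ((P ε).coeff e ξ η))
      (iteratedFDeriv ℝ j (P₀.coeff e ξ η)) (𝓝[>] (0 : ℝ)) K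

/-! ### `b^m`-geometry of the triple `(M, Z, x)`, where `Z = {x = 0}` -/

/-- The fibre at `p` of the `b^m`-tangent bundle of `(M, Z, x)`, realized as
`{(v, s) | dx(v) = x(p) ^ m * s}` inside `T_p M × ℝ`. Its sections are the vector fields `X`
for which `dx(X)` is divisible by `x ^ m`, together with the quotient `s`.
At `p ∉ Z` it is a copy of `T_p M` (with `s = dx(v) / x ^ m`), and for `m ≥ 1` and `p ∈ Z` it is
`T_p Z ⊕ ℝ`, the vector `(0, 1)` standing for `x ^ m ∂/∂x`. -/
def BTan (x : M → ℝ) (m : ℕ) (p : M) : Submodule ℝ (Tan E p × ℝ) where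
  carrier := {u | dAt x p u.1 = x p ^ m * u.2}
  add_mem' := by
    intro a b ha hb
    simp only [Set.mem_ofPred_eq, Prod.fst_add, Prod.snd_add, map_add] at *
    rw [ha, hb, mul_add]
  zero_mem' := by simp
  smul_mem' := by
    intro c a ha
    simp only [Set.mem_ofPred_eq, Prod.smul_fst, Prod.smul_snd, map_smul, smul_eq_mul] at *
    rw [ha, mul_left_comm]

/-- The anchor map from the `b^m`-tangent space to the tangent space. -/
def anchor (x : M → ℝ) (m : ℕ) (p : M) : BTan (E := E) x m p →L[ℝ] Tan E p :=
  (ContinuousLinearMap.fst ℝ (Tan E p) ℝ).comp (BTan (E := E) x m p).subtypeL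

/-- The `b^m`-covector `dx / x ^ m`. -/
def dxOver (x : M → ℝ) (m : ℕ) (p : M) : BTan (E := E) x m p [⋀^Fin 1]→L[ℝ] ℝ :=
  ContinuousAlternatingMap.ofSubsingleton ℝ (BTan (E := E) x m p) ℝ 0
    ((ContinuousLinearMap.snd ℝ (Tan E p) ℝ).comp (BTan (E := E) x m p).subtypeL)

/-- At a point off `Z`, the inverse of the anchor map: `v ↦ (v, dx(v) / x ^ m)`. -/
def lift (x : M → ℝ) (m : ℕ) (p : M) (hp : x p ≠ 0) : Tan E p →L[ℝ] BTan (E := E) x m p :=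
  ((ContinuousLinearMap.id ℝ (Tan E p)).prod ((x p ^ m)⁻¹ • dAt x p)).codRestrict
    (BTan (E := E) x m p)
    (fun v => (mul_inv_cancel_left₀ (pow_ne_zero m hp) (dAt x p v)).symm)

/-- (Not necessarily continuous) sections of the second exterior power of the `b^m`-cotangent
bundle. -/
abbrev BForm (E : Type*) [NormedAddCommGroup E] [NormedSpace ℝ E] {M : Type*} [TopologicalSpace M]
    [ChartedSpace E M] (x : M → ℝ) (m : ℕ) : Type _ :=
  ∀ p : M, BTan (E := E) x m p [⋀^Fin 2]→L[ℝ] ℝ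

/-- The `b^m`-form `(dx / x ^ m) ∧ α + β`, where `α` and `β` are ordinary forms. -/
def BForm.ofForms (x : M → ℝ) (m : ℕ) (α : DForm E M 1) (β : DForm E M 2) : BForm E x m := fun p =>
  wedge (dxOver x m p) ((α p).compContinuousLinearMap (anchor x m p))
    + (β p).compContinuousLinearMap (anchor x m p)

/-- The ordinary 2-form that a `b^m`-form defines on `M \ Z` (extended by zero to `Z`). -/
def BForm.toForm {x : M → ℝ} {m : ℕ} (Ω : BForm E x m) : DForm E M 2 := fun p =>
  if hp : x p ≠ 0 then (Ω p).compContinuousLinearMap (lift x m p hp) else 0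

/-- A `b^m`-symplectic form: a smooth, closed `b^m`-form of degree 2 that has maximal rank, as a
form on the `b^m`-tangent space, at every point of `M`, including the points of `Z`.
Smooth sections are those that locally are `(dx / x ^ m) ∧ α + β` with smooth `α` and `β`;
closedness may be tested on the dense set `M \ Z`. -/
structure BForm.IsBSymplectic {x : M → ℝ} {m : ℕ} (Ω : BForm E x m) : Prop where
  smooth : ∀ p : M, ∃ V : Set M, IsOpen V ∧ p ∈ V ∧
    ∃ (α : DForm E M 1) (β : DForm E M 2), α.SmoothOn V ∧ β.SmoothOn V ∧
      ∀ q ∈ V, Ω q = BForm.ofForms x m α β q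
  closed : Ω.toForm.ClosedOn {p | x p ≠ 0}
  nondegenerate : ∀ p, Nondegenerate (Ω p)

/-- The bivector field `Ω⁻¹` on `M` dual to a `b^m`-symplectic form (its Poisson structure): the
image under the anchor map of the bivector on the `b^m`-tangent space dual to `Ω`. -/
def BForm.poisson {x : M → ℝ} {m : ℕ} (Ω : BForm E x m) : BivectorField E M := fun p =>
  (dualBivector (Ω p)).compLinearMap
    (Module.Dual.transpose (R := ℝ) (anchor (E := E) x m p).toLinearMap)

/-- The 1-form `∑ i < m, x ^ i π^* a_i`. -/
def laurentSum {m : ℕ} (x : M → ℝ) (π : M → N) (a : Fin m → DForm F N 1) : DForm E M 1 := fun p =>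
  ∑ i : Fin m, x p ^ (i : ℕ) • DForm.pullback (E := E) π (a i) p

/-- A Laurent series of the `b^m`-form `Ω` along the hypersurface `Z = {x = 0}`, which is given as
the image of an embedding `ι : N → M`: on a neighbourhood `U` of `Z` with a smooth projection
`π : U → Z`, one has `Ω = (dx / x ^ m) ∧ (∑ i < m, x ^ i π^* a_i) + β` with closed smooth 1-forms
`a_i` on `Z` and a smooth 2-form `β` on `U`. (The values of `π` and `β` off `U` are irrelevant.) -/
structure IsLaurentSeries {x : M → ℝ} {m : ℕ} (Ω : BForm E x m) (ι : N → M)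
    (U : Set M) (π : M → N) (a : Fin m → DForm F N 1) (β : DForm E M 2) : Prop where
  isOpen : IsOpen U
  subset : {p | x p = 0} ⊆ U
  smooth_proj : ContMDiffOn 𝓘(ℝ, E) 𝓘(ℝ, F) ∞ π U
  proj : ∀ z, π (ι z) = z
  smooth_a : ∀ i, (a i).SmoothOn Set.univ
  closed_a : ∀ i, (a i).ClosedOn Set.univ
  smooth_beta : β.SmoothOn U
  eq : ∀ p ∈ U, Ω p = BForm.ofForms x m (laurentSum x π a) β p

/-! ### Desingularization -/

/-- The functions `f` used for desingularizing `b^{2k}`-forms. -/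
structure IsDesingularizer (k : ℕ) (f : ℝ → ℝ) : Prop where
  smooth : ContDiff ℝ ∞ f
  odd : ∀ t, f (-t) = -f t
  deriv_pos : ∀ t ∈ Set.Icc (-1 : ℝ) 1, 0 < deriv f t
  eq_left : ∀ t < -1, f t = -1 / ((2 * (k : ℝ) - 1) * t ^ (2 * k - 1)) - 2
  eq_right : ∀ t > 1, f t = -1 / ((2 * (k : ℝ) - 1) * t ^ (2 * k - 1)) + 2

/-- `f_ε(t) = ε^{-(2k-1)} f(t / ε)`. -/
def scale (k : ℕ) (f : ℝ → ℝ) (ε t : ℝ) : ℝ := 1 / ε ^ (2 * k - 1) * f (t / ε)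

open Classical in
/-- The `f_ε`-desingularization `Ω_ε` of the `b^{2k}`-form `Ω`, with respect to a Laurent series:
`d(f_ε ∘ x) ∧ (∑ i < 2k, x ^ i π^* a_i) + β` on `U`, and `Ω` off `U`. -/
def desingularization {k : ℕ} {x : M → ℝ} (Ω : BForm E x (2 * k)) (U : Set M) (π : M → N)
    (a : Fin (2 * k) → DForm F N 1) (β : DForm E M 2) (f : ℝ → ℝ) (ε : ℝ) : DForm E M 2 := fun p =>
  if p ∈ U then
    wedge (diff (fun q => scale k f ε (x q)) p) (laurentSum x π a p) + β p
  else Ω.toForm p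

end Manifold

end BSymplectic

end

namespace BSymplectic

/-! ### Smoothness of families of linear maps and of alternating forms -/

section Smoothness

variable {D : Type*} [NormedAddCommGroup D] [NormedSpace ℝ D]
  {V : Type*} [NormedAddCommGroup V] [NormedSpace ℝ V] [FiniteDimensional ℝ V]
  {W : Type*} [NormedAddCommGroup W] [NormedSpace ℝ W]

/-! Put `α = ∑ x^i π^* a_i`. On `U` both forms have the shape `μ⁻¹ dx ∧ α + β`: for `ω` the
parameter is `μ = x^{2k}`, and for `ω_ε` it is `μ_ε = 1 / f_ε'(x) = ε^{2k} / f'(x/ε)` (`invDeriv`).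
Everything reduces to understanding how the dual bivector of such a form depends on `μ`, down to `μ
= 0`.

To solve `ι_v (μ⁻¹ ξ ∧ α + β) = η`, introduce the unknowns `s = ξ(v)/μ` and `t = -α(v)/μ`. The
resulting linear system for `(v, s, t)` (`border`) is affine in `μ` and makes sense at `μ = 0`.
There it is invertible because `ω` has maximal rank on the `b`-tangent space and `dx ≠ 0`
(`borderVia_injective_of_nondegenerate`). Hence the coefficients of both bivectors are values of one
function `chartDual` of the point and of `μ`, smooth wherever the system is invertible
(`coeff_poisson`, `coeff_dualBivector`).

Nondegeneracy: on `|x| ≤ ε` write `x = ε s` with `|s| ≤ 1`. The parameter is `ε^{2k} / f'(s)`, which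
tends to `0` uniformly in `s`; openness of invertibility and compactness of `[-1, 1]` and of `M`
give a uniform threshold for `ε` (`exists_nondegenerate_desingularization`). For `|t| ≥ ε` one has
`f_ε'(t) = t^{-2k}`, so the forms agree there.

Closedness: each `γ(x) x^i dx ∧ π^* a_i` is `d(h_i(x) π^* a_i)` with `h_i' = γ t^i`
(`extDeriv_conormalForm_laurentSum`). So `dω_ε = dβ` on `U`, and `dβ` vanishes off `Z`, hence on `Z`
by continuity (`extDeriv_beta`).

Convergence: a resolvent identity (`chartDual_eq_add`) writes the difference of the bivector
coefficients as `x^{2k} - μ_ε = ε^{2k} (s^{2k} - 1/f'(s))` times a smooth factor. Each derivative of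
a function of `x/ε` costs `1/ε`, so derivatives of order `j` are `O(ε^{2k-j})`, which tends to `0`
exactly in the range `j ≤ 2k - 1` (`eventually_norm_iteratedFDeriv_sub_lt`). -/

theorem contDiffAt_clm_of_apply {n : ℕ∞ω} {f : D → V →L[ℝ] W} {y : D}
    (h : ∀ v, ContDiffAt ℝ n (fun z => f z v) y) : ContDiffAt ℝ n f y := by
  let b := Module.finBasis ℝ V
  have e : f = fun z => ∑ i, (LinearMap.toContinuousLinearMap (b.coord i)).smulRight (f z (b i)) := by
    funext z
    refine ContinuousLinearMap.coe_injective (b.ext fun j => ?_)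
    simp [Finsupp.single_apply]
  rw [e]
  refine ContDiffAt.sum fun i _ => ?_
  exact ((ContinuousLinearMap.smulRightL ℝ V W
    (LinearMap.toContinuousLinearMap (b.coord i))).contDiff.contDiffAt).comp y (h (b i))

/-- Values on tuples of basis vectors determine an alternating form, so this evaluation map is
injective and has a linear left inverse, continuous by finite dimension. It reduces smoothness of
families of forms to smoothness of scalar functions. -/
theorem exists_continuousLinear_reconstruction (k : ℕ) :
    ∃ (d : ℕ) (v : Fin d → Fin k → V) (R : (Fin d → ℝ) →L[ℝ] V [⋀^Fin k]→L[ℝ] ℝ),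
      ∀ Ω : V [⋀^Fin k]→L[ℝ] ℝ, R (fun i => Ω (v i)) = Ω := by
  classical
  let b := Module.finBasis ℝ V
  let t : Fin (Fintype.card (Fin k → Fin (Module.finrank ℝ V))) ≃ (Fin k → Fin (Module.finrank ℝ V)) :=
    (Fintype.equivFin _).symm
  let ev : (V [⋀^Fin k]→L[ℝ] ℝ) →ₗ[ℝ]
      (Fin (Fintype.card (Fin k → Fin (Module.finrank ℝ V))) → ℝ) :=
    { toFun := fun Ω i => Ω fun j => b (t i j)
      map_add' := fun _ _ => rfl
      map_smul' := fun _ _ => rfl }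
  have hev : LinearMap.ker ev = ⊥ := by
    rw [LinearMap.ker_eq_bot]
    intro Ω Ω' h
    apply ContinuousAlternatingMap.toAlternatingMap_injective
    refine Module.Basis.ext_alternating b fun w _ => ?_
    have := congrFun h (t.symm w)
    simpa [ev] using this
  obtain ⟨R, hR⟩ := ev.exists_leftInverse_of_injective hev
  exact ⟨_, fun i j => b (t i j), LinearMap.toContinuousLinearMap R,
    fun Ω => LinearMap.congr_fun hR Ω⟩

theorem contDiffAt_form_of_apply {n : ℕ∞ω} {k : ℕ} {f : D → V [⋀^Fin k]→L[ℝ] ℝ} {y : D}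
    (h : ∀ v, ContDiffAt ℝ n (fun z => f z v) y) : ContDiffAt ℝ n f y := by
  obtain ⟨d, v, R, hR⟩ := exists_continuousLinear_reconstruction (V := V) k
  have e : f = fun z => R (fun i => f z (v i)) := funext fun z => (hR _).symm
  rw [e]
  exact R.contDiff.contDiffAt.comp y (contDiffAt_pi.2 fun i => h (v i))

theorem _root_.ContDiffAt.form_apply {n : ℕ∞ω} {k : ℕ} {f : D → V [⋀^Fin k]→L[ℝ] ℝ}
    {v : D → Fin k → V} {y : D} (hf : ContDiffAt ℝ n f y) (hv : ∀ i, ContDiffAt ℝ n (fun z => v z i) y) :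
    ContDiffAt ℝ n (fun z => f z (v z)) y := by
  obtain ⟨d, w, R, hR⟩ := exists_continuousLinear_reconstruction (V := V) k
  let ev (u : Fin k → V) : (V [⋀^Fin k]→L[ℝ] ℝ) →L[ℝ] ℝ :=
    ContinuousAlternatingMap.apply ℝ V ℝ u
  -- Expanding in the finitely many fixed forms `R (Pi.single i 1)` separates the dependence of the
  -- form on `z` from that of its arguments.
  have e : (fun z => f z (v z)) = fun z => ∑ i, f z (w i) * R (Pi.single i 1) (v z) := by
    funext z
    conv_lhs => rw [← hR (f z)]
    have : (fun i => f z (w i)) = ∑ i, f z (w i) • (Pi.single i (1 : ℝ) : Fin d → ℝ) := by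
      funext j
      simp [Finset.sum_apply, Pi.single_apply]
    rw [this, map_sum]
    simp
  rw [e]
  refine ContDiffAt.sum fun i _ => ContDiffAt.mul ?_ ?_
  · exact (ev (w i)).contDiff.contDiffAt.comp y hf
  · exact (R (Pi.single i 1)).toContinuousMultilinearMap.contDiff.contDiffAt.comp y
      (contDiffAt_pi.2 hv)

theorem _root_.ContDiffAt.wedge {n : ℕ∞ω} {a b : D → V [⋀^Fin 1]→L[ℝ] ℝ} {y : D}
    (ha : ContDiffAt ℝ n a y) (hb : ContDiffAt ℝ n b y) :
    ContDiffAt ℝ n (fun z => wedge (a z) (b z)) y := by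
  refine contDiffAt_form_of_apply fun v => ?_
  change ContDiffAt ℝ n (fun z => a z ![v 0] * b z ![v 1] - a z ![v 1] * b z ![v 0]) y
  have h {c : D → V [⋀^Fin 1]→L[ℝ] ℝ} (hc : ContDiffAt ℝ n c y) (u : V) :
      ContDiffAt ℝ n (fun z => c z ![u]) y :=
    hc.form_apply (v := fun _ => ![u]) fun _ => contDiffAt_const
  exact ((h ha _).mul (h hb _)).sub ((h ha _).mul (h hb _))

theorem _root_.ContDiffAt.ofSubsingleton {n : ℕ∞ω} {a : D → V →L[ℝ] ℝ} {y : D}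
    (ha : ContDiffAt ℝ n a y) :
    ContDiffAt ℝ n (fun z => ContinuousAlternatingMap.ofSubsingleton ℝ V ℝ (0 : Fin 1) (a z)) y :=
  contDiffAt_form_of_apply fun v => by
    change ContDiffAt ℝ n (fun z => a z (v 0)) y
    exact ha.clm_apply contDiffAt_const

theorem _root_.ContDiffAt.form_compContinuousLinearMap {V' : Type*} [NormedAddCommGroup V']
    [NormedSpace ℝ V'] [FiniteDimensional ℝ V'] {n : ℕ∞ω} {k : ℕ} {f : D → V [⋀^Fin k]→L[ℝ] ℝ}
    {L : D → V' →L[ℝ] V} {y : D} (hf : ContDiffAt ℝ n f y) (hL : ContDiffAt ℝ n L y) :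
    ContDiffAt ℝ n (fun z => (f z).compContinuousLinearMap (L z)) y :=
  contDiffAt_form_of_apply fun v => by
    change ContDiffAt ℝ n (fun z => f z (fun i => L z (v i))) y
    exact hf.form_apply fun i => hL.clm_apply contDiffAt_const

end Smoothness

/-! ### Nondegenerate 2-forms and their duals -/

section Duals

variable {V : Type*} [AddCommGroup V] [Module ℝ V] [TopologicalSpace V]

theorem form_swap (Ω : V [⋀^Fin 2]→L[ℝ] ℝ) (v w : V) : Ω ![v, w] = - Ω ![w, v] := by
  have h := Ω.toAlternatingMap.map_swap ![w, v] (show (0 : Fin 2) ≠ 1 by decide)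
  have e : ![w, v] ∘ (Equiv.swap (0 : Fin 2) 1) = ![v, w] := by
    ext i; fin_cases i <;> simp
  rw [e] at h
  exact h

theorem flat_bijective [FiniteDimensional ℝ V] {Ω : V [⋀^Fin 2]→L[ℝ] ℝ} (h : Nondegenerate Ω) :
    Function.Bijective (flat Ω) := by
  have hi : Function.Injective (flat Ω) := by
    rw [← LinearMap.ker_eq_bot, LinearMap.ker_eq_bot']
    exact fun v hv => h v fun w => LinearMap.congr_fun hv w
  exact ⟨hi, (LinearMap.injective_iff_surjective_of_finrank_eq_finrank
    (Subspace.dual_finrank_eq (K := ℝ) (V := V)).symm).1 hi⟩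

/-- `Ω⁻¹(ξ, η) = Ω(u, sharp η) = -Ω(sharp η, u)`. One solution `u` of `ι_u Ω = ξ` thus suffices,
without computing `sharp`. -/
theorem dualBivector_eq_of_flat_eq [FiniteDimensional ℝ V] {Ω : V [⋀^Fin 2]→L[ℝ] ℝ}
    (h : Nondegenerate Ω) {u : V} {ξ : Module.Dual ℝ V} (hu : flat Ω u = ξ) (η : Module.Dual ℝ V) :
    dualBivector Ω ![ξ, η] = - η u := by
  have hb := flat_bijective h
  have hs : ∀ ζ, flat Ω (sharp Ω ζ) = ζ := fun ζ => by
    rw [sharp, dif_pos hb]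
    exact (LinearEquiv.ofBijective (flat Ω) hb).apply_symm_apply ζ
  have h1 : sharp Ω ξ = u := hb.1 ((hs ξ).trans hu.symm)
  have h2 : dualBivector Ω ![ξ, η] = Ω ![sharp Ω ξ, sharp Ω η] := by
    change Ω (fun i => sharp Ω (![ξ, η] i)) = _
    congr 1
    ext i; fin_cases i <;> rfl
  rw [h2, h1, form_swap]
  exact congrArg Neg.neg (LinearMap.congr_fun (hs η) u)

end Duals

/-! ### The bordered system of a form `μ⁻¹ ξ ∧ α + β`, which extends to `μ = 0` -/

section Border

variable {E : Type*} [NormedAddCommGroup E] [NormedSpace ℝ E] [FiniteDimensional ℝ E]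

/-- The linear system for `(v, s, t)` whose solutions with right-hand side `(η, 0, 0)` have
`ι_v (μ⁻¹ ξ ∧ α + β) = η` when `μ ≠ 0`. -/
noncomputable def border (ξ : E →L[ℝ] ℝ) (α : E [⋀^Fin 1]→L[ℝ] ℝ) (β : E [⋀^Fin 2]→L[ℝ] ℝ) (μ : ℝ) :
    E × ℝ × ℝ →L[ℝ] (E →L[ℝ] ℝ) × ℝ × ℝ :=
  LinearMap.toContinuousLinearMap
    { toFun := fun z => (LinearMap.toContinuousLinearMap (flat β z.1)
          + z.2.1 • (ContinuousAlternatingMap.ofSubsingleton ℝ E ℝ (0 : Fin 1)).symm α + z.2.2 • ξ,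
        α ![z.1] + z.2.2 * μ, ξ z.1 - μ * z.2.1)
      map_add' := fun z w => by
        simp only [Prod.fst_add, Prod.snd_add, map_add, covector_add, Prod.mk_add_mk, add_smul,
          Prod.mk.injEq]
        exact ⟨by abel, by ring, by ring⟩
      map_smul' := fun c z => by
        simp only [Prod.smul_fst, Prod.smul_snd, map_smul, covector_smul, Prod.smul_mk, smul_add,
          smul_eq_mul, mul_smul, RingHom.id_apply, Prod.mk.injEq, true_and]
        exact ⟨by ring, by ring⟩ }

theorem border_apply_fst (ξ : E →L[ℝ] ℝ) (α : E [⋀^Fin 1]→L[ℝ] ℝ) (β : E [⋀^Fin 2]→L[ℝ] ℝ) (μ : ℝ)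
    (z : E × ℝ × ℝ) (w : E) :
    (border ξ α β μ z).1 w = β ![z.1, w] + z.2.1 * α ![w] + z.2.2 * ξ w := by
  have h : (ContinuousAlternatingMap.ofSubsingleton ℝ E ℝ (0 : Fin 1)).symm α w = α ![w] := by
    change α (fun _ => w) = _
    congr 1
    ext i; fin_cases i; rfl
  rw [← h]
  rfl

theorem border_apply_snd (ξ : E →L[ℝ] ℝ) (α : E [⋀^Fin 1]→L[ℝ] ℝ) (β : E [⋀^Fin 2]→L[ℝ] ℝ) (μ : ℝ)
    (z : E × ℝ × ℝ) :
    (border ξ α β μ z).2 = (α ![z.1] + z.2.2 * μ, ξ z.1 - μ * z.2.1) := rfl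

/-- `border` is affine in `μ`, with this linear part. -/
noncomputable def borderSlope (E : Type*) [NormedAddCommGroup E] [NormedSpace ℝ E] :
    E × ℝ × ℝ →L[ℝ] (E →L[ℝ] ℝ) × ℝ × ℝ :=
  ((0 : E × ℝ × ℝ →L[ℝ] (E →L[ℝ] ℝ))).prod
    (((ContinuousLinearMap.snd ℝ ℝ ℝ).comp (ContinuousLinearMap.snd ℝ E (ℝ × ℝ))).prod
      (-((ContinuousLinearMap.fst ℝ ℝ ℝ).comp (ContinuousLinearMap.snd ℝ E (ℝ × ℝ)))))

theorem border_sub_border (ξ : E →L[ℝ] ℝ) (α : E [⋀^Fin 1]→L[ℝ] ℝ) (β : E [⋀^Fin 2]→L[ℝ] ℝ)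
    (μ ν : ℝ) : border ξ α β μ - border ξ α β ν = (μ - ν) • borderSlope E := by
  refine ContinuousLinearMap.ext fun z => Prod.ext ?_ ?_
  · refine ContinuousLinearMap.ext fun w => ?_
    change (border ξ α β μ z).1 w - (border ξ α β ν z).1 w = (μ - ν) * (0 : E →L[ℝ] ℝ) w
    simp [border_apply_fst]
  · change (border ξ α β μ z).2 - (border ξ α β ν z).2 = (μ - ν) • (z.2.2, - z.2.1)
    simp only [border_apply_snd, Prod.mk_sub_mk, Prod.smul_mk, smul_eq_mul, Prod.mk.injEq]
    constructor <;> ring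

/-- The system is square: both sides have dimension `dim E + 2`. -/
theorem isInvertible_border {ξ : E →L[ℝ] ℝ} {α : E [⋀^Fin 1]→L[ℝ] ℝ} {β : E [⋀^Fin 2]→L[ℝ] ℝ} {μ : ℝ}
    (h : Function.Injective (border ξ α β μ)) : (border ξ α β μ).IsInvertible := by
  have hd : Module.finrank ℝ (E →L[ℝ] ℝ) = Module.finrank ℝ E := by
    rw [← LinearMap.toContinuousLinearMap.finrank_eq]
    exact Subspace.dual_finrank_eq
  have hf : Module.finrank ℝ (E × ℝ × ℝ) = Module.finrank ℝ ((E →L[ℝ] ℝ) × ℝ × ℝ) := by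
    simp only [Module.finrank_prod, hd]
  refine ⟨((border ξ α β μ).toLinearMap.linearEquivOfInjective h hf).toContinuousLinearEquiv, ?_⟩
  exact ContinuousLinearMap.ext fun z => rfl

theorem _root_.ContDiffAt.border {D : Type*} [NormedAddCommGroup D] [NormedSpace ℝ D] {n : ℕ∞ω} {y : D}
    {ξ : D → E →L[ℝ] ℝ} {α : D → E [⋀^Fin 1]→L[ℝ] ℝ} {β : D → E [⋀^Fin 2]→L[ℝ] ℝ} {μ : D → ℝ}
    (hξ : ContDiffAt ℝ n ξ y) (hα : ContDiffAt ℝ n α y) (hβ : ContDiffAt ℝ n β y)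
    (hμ : ContDiffAt ℝ n μ y) :
    ContDiffAt ℝ n (fun z => border (ξ z) (α z) (β z) (μ z)) y := by
  refine contDiffAt_clm_of_apply fun v => ?_
  have ha (u : E) : ContDiffAt ℝ n (fun z => α z ![u]) y :=
    hα.form_apply (v := fun _ => ![u]) fun _ => contDiffAt_const
  have hb (u w : E) : ContDiffAt ℝ n (fun z => β z ![u, w]) y :=
    hβ.form_apply (v := fun _ => ![u, w]) fun _ => contDiffAt_const
  have hx (u : E) : ContDiffAt ℝ n (fun z => ξ z u) y := hξ.clm_apply contDiffAt_const
  have h1 : ContDiffAt ℝ n (fun z => (BSymplectic.border (ξ z) (α z) (β z) (μ z) v).1) y := by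
    refine contDiffAt_clm_of_apply fun w => ?_
    simp only [border_apply_fst]
    exact ((hb _ _).add (contDiffAt_const.mul (ha w))).add (contDiffAt_const.mul (hx w))
  have h2 : ContDiffAt ℝ n (fun z => (BSymplectic.border (ξ z) (α z) (β z) (μ z) v).2) y := by
    simp only [border_apply_snd]
    exact ((ha _).add (contDiffAt_const.mul hμ)).prodMk ((hx _).sub (hμ.mul contDiffAt_const))
  exact h1.prodMk h2

variable {V : Type*} [AddCommGroup V] [Module ℝ V] [TopologicalSpace V]
  (L : E →L[ℝ] V) (ξ : V →L[ℝ] ℝ) (α : V [⋀^Fin 1]→L[ℝ] ℝ) (β : V [⋀^Fin 2]→L[ℝ] ℝ) (μ : ℝ)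

/-- The bordered system of forms on `V`, written in the coordinate space `E`. -/
noncomputable abbrev borderVia : E × ℝ × ℝ →L[ℝ] (E →L[ℝ] ℝ) × ℝ × ℝ :=
  border (ξ.comp L) (α.compContinuousLinearMap L) (β.compContinuousLinearMap L) μ

variable {L ξ α β μ}

theorem borderVia_eq_iff (hL : Function.Surjective L) (z : E × ℝ × ℝ) (η : V →L[ℝ] ℝ) :
    borderVia L ξ α β μ z = (η.comp L, 0, 0) ↔
      (∀ w, β ![L z.1, w] + z.2.1 * α ![w] + z.2.2 * ξ w = η w) ∧
        α ![L z.1] + z.2.2 * μ = 0 ∧ ξ (L z.1) = μ * z.2.1 := by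
  have e2 (u w : E) : β.compContinuousLinearMap L ![u, w] = β ![L u, L w] := by
    change β (fun i => L (![u, w] i)) = _
    congr 1
    ext i; fin_cases i <;> rfl
  have e1 (u : E) : α.compContinuousLinearMap L ![u] = α ![L u] := by
    change α (fun i => L (![u] i)) = _
    congr 1
    ext i; fin_cases i; rfl
  rw [Prod.ext_iff, border_apply_snd, Prod.mk.injEq, e1, ContinuousLinearMap.coe_comp,
    Function.comp_apply, sub_eq_zero, ContinuousLinearMap.ext_iff, hL.forall]
  simp only [border_apply_fst, e1, e2]
  rfl

/-! ### The bordered system and forms on the subspace `ξ(v) = μ s` of `V × ℝ` (the `b`-tangent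
space) -/

section Submodule

variable {K : Submodule ℝ (V × ℝ)} {Ω : K [⋀^Fin 2]→L[ℝ] ℝ}

/-- `Ω` is the restriction to `K` of `s α(w) - r α(v) + β(v, w)`, taken on pairs `(v, s)`, `(w, r)`
in `V × ℝ`. The border unknown `t` is a Lagrange multiplier for the functional `(ξ, -μ)`, whose
kernel is `K`: its contribution disappears on vectors of `K`. -/
theorem form_apply_of_borderVia_eq (hL : Function.Surjective L)
    (hK : ∀ u : V × ℝ, u ∈ K ↔ ξ u.1 = μ * u.2)
    (hΩ : ∀ u w : K, Ω ![u, w] =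
      u.1.2 * α ![w.1.1] - w.1.2 * α ![u.1.1] + β ![u.1.1, w.1.1])
    {z : E × ℝ × ℝ} {η : V →L[ℝ] ℝ} (hz : borderVia L ξ α β μ z = (η.comp L, 0, 0)) :
    ∃ h : (L z.1, z.2.1) ∈ K, ∀ w : K, Ω ![⟨(L z.1, z.2.1), h⟩, w] = η w.1.1 := by
  obtain ⟨h1, h2, h3⟩ := (borderVia_eq_iff hL z η).1 hz
  refine ⟨(hK _).2 h3, fun w => ?_⟩
  rw [hΩ, ← h1]
  linear_combination (-w.1.2) * h2 - z.2.2 * (hK _).1 w.2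

theorem borderVia_injective_of_nondegenerate (hL : Function.Bijective L)
    (hK : ∀ u : V × ℝ, u ∈ K ↔ ξ u.1 = μ * u.2)
    (hΩ : ∀ u w : K, Ω ![u, w] =
      u.1.2 * α ![w.1.1] - w.1.2 * α ![u.1.1] + β ![u.1.1, w.1.1])
    (hξ : μ = 0 → ξ ≠ 0) (hnd : Nondegenerate Ω) : Function.Injective (borderVia L ξ α β μ) := by
  refine (injective_iff_map_eq_zero _).2 fun z hz => ?_
  have hz' : borderVia L ξ α β μ z = ((0 : V →L[ℝ] ℝ).comp L, 0, 0) := by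
    rw [hz, ContinuousLinearMap.zero_comp]; rfl
  obtain ⟨h, hw⟩ := form_apply_of_borderVia_eq hL.2 hK hΩ hz'
  have h0 := hnd _ hw
  rw [Subtype.ext_iff] at h0
  obtain ⟨h1, h2, -⟩ := (borderVia_eq_iff hL.2 z 0).1 hz'
  have hv : L z.1 = 0 := congrArg Prod.fst h0
  have hs : z.2.1 = 0 := congrArg Prod.snd h0
  have hz1 : z.1 = 0 := hL.1 (hv.trans (map_zero L).symm)
  have hβ (w : V) : β ![0, w] = 0 := by
    exact LinearMap.congr_fun (map_zero (flat β)) w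
  have hα : α ![0] = 0 := by simpa using covector_smul α 0 0
  simp only [hv, hs, hβ, hα, zero_mul, zero_add, zero_apply] at h1 h2
  -- What remains of the system is `t ξ = 0` and `t μ = 0`. This is the only place that needs `ξ ≠
  -- 0` when `μ = 0`.
  have ht : z.2.2 = 0 := by
    by_contra ht
    refine hξ ((mul_eq_zero.1 h2).resolve_left ht) (ContinuousLinearMap.ext fun w => ?_)
    exact (mul_eq_zero.1 (h1 w)).resolve_left ht
  exact Prod.ext hz1 (Prod.ext hs ht)

theorem dualBivector_eq_of_borderVia_eq_submodule [FiniteDimensional ℝ V]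
    (hL : Function.Surjective L) (hK : ∀ u : V × ℝ, u ∈ K ↔ ξ u.1 = μ * u.2)
    (hΩ : ∀ u w : K, Ω ![u, w] =
      u.1.2 * α ![w.1.1] - w.1.2 * α ![u.1.1] + β ![u.1.1, w.1.1])
    (hnd : Nondegenerate Ω) {z : E × ℝ × ℝ} {η : V →L[ℝ] ℝ}
    (hz : borderVia L ξ α β μ z = (η.comp L, 0, 0)) {ζ ζ' : Module.Dual ℝ K}
    (hζ : ∀ w : K, ζ w = η w.1.1) (θ : Module.Dual ℝ V) (hζ' : ∀ w : K, ζ' w = θ w.1.1) :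
    dualBivector Ω ![ζ, ζ'] = - θ (L z.1) := by
  obtain ⟨h, hw⟩ := form_apply_of_borderVia_eq hL hK hΩ hz
  rw [dualBivector_eq_of_flat_eq hnd (LinearMap.ext fun w => (hw w).trans (hζ w).symm), hζ']

end Submodule

/-! ### The bordered system and ordinary 2-forms, for `μ ≠ 0` -/

section Ambient

variable {Ω : V [⋀^Fin 2]→L[ℝ] ℝ}

theorem nondegenerate_of_borderVia_injective (hL : Function.Surjective L) (hμ : μ ≠ 0)
    (hΩ : ∀ u w : V, Ω ![u, w] = μ⁻¹ * (ξ u * α ![w] - ξ w * α ![u]) + β ![u, w])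
    (h : Function.Injective (borderVia L ξ α β μ)) : Nondegenerate Ω := by
  intro v hv
  obtain ⟨v, rfl⟩ := hL v
  -- For `μ ≠ 0` the last two equations force `s = ξ(v)/μ` and `t = -α(v)/μ`, and the first becomes
  -- `ι_v Ω = 0`.
  have hz : borderVia L ξ α β μ (v, μ⁻¹ * ξ (L v), - μ⁻¹ * α ![L v])
      = ((0 : V →L[ℝ] ℝ).comp L, 0, 0) := by
    refine (borderVia_eq_iff hL _ _).2 ⟨fun w => ?_, ?_, ?_⟩
    · rw [zero_apply, ← hv w, hΩ]
      ring
    · field_simp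
      ring
    · field_simp
  have h0 := h (hz.trans (show _ = borderVia L ξ α β μ 0 by
    rw [map_zero, ContinuousLinearMap.zero_comp]; rfl))
  rw [show v = 0 from congrArg Prod.fst h0, map_zero]

theorem flat_eq_of_borderVia_eq (hL : Function.Surjective L) (hμ : μ ≠ 0)
    (hΩ : ∀ u w : V, Ω ![u, w] = μ⁻¹ * (ξ u * α ![w] - ξ w * α ![u]) + β ![u, w])
    {z : E × ℝ × ℝ} {η : V →L[ℝ] ℝ} (hz : borderVia L ξ α β μ z = (η.comp L, 0, 0)) (w : V) :
    Ω ![L z.1, w] = η w := by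
  obtain ⟨h1, h2, h3⟩ := (borderVia_eq_iff hL z η).1 hz
  rw [hΩ, ← h1, h3, show α ![L z.1] = - (z.2.2 * μ) by linear_combination h2]
  field_simp
  ring

theorem borderVia_injective_of_nondegenerate' (hL : Function.Bijective L) (hμ : μ ≠ 0)
    (hΩ : ∀ u w : V, Ω ![u, w] = μ⁻¹ * (ξ u * α ![w] - ξ w * α ![u]) + β ![u, w])
    (hnd : Nondegenerate Ω) : Function.Injective (borderVia L ξ α β μ) := by
  refine (injective_iff_map_eq_zero _).2 fun z hz => ?_
  have hz' : borderVia L ξ α β μ z = ((0 : V →L[ℝ] ℝ).comp L, 0, 0) := by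
    rw [hz, ContinuousLinearMap.zero_comp]; rfl
  have hv : L z.1 = 0 := hnd _ (flat_eq_of_borderVia_eq hL.2 hμ hΩ hz')
  obtain ⟨-, h2, h3⟩ := (borderVia_eq_iff hL.2 z 0).1 hz'
  have hα : α ![0] = 0 := by simpa using covector_smul α 0 0
  rw [hv, hα, zero_add] at h2
  rw [hv, map_zero] at h3
  exact Prod.ext (hL.1 (hv.trans (map_zero L).symm))
    (Prod.ext ((mul_eq_zero.1 h3.symm).resolve_left hμ) ((mul_eq_zero.1 h2).resolve_right hμ))

theorem dualBivector_eq_of_borderVia_eq [FiniteDimensional ℝ V] (hL : Function.Surjective L)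
    (hμ : μ ≠ 0)
    (hΩ : ∀ u w : V, Ω ![u, w] = μ⁻¹ * (ξ u * α ![w] - ξ w * α ![u]) + β ![u, w])
    (hnd : Nondegenerate Ω)
    {z : E × ℝ × ℝ} {η : V →L[ℝ] ℝ} (hz : borderVia L ξ α β μ z = (η.comp L, 0, 0))
    (θ : Module.Dual ℝ V) :
    dualBivector Ω ![η.toLinearMap, θ] = - θ (L z.1) :=
  dualBivector_eq_of_flat_eq hnd
    (LinearMap.ext fun w => flat_eq_of_borderVia_eq hL hμ hΩ hz w) θ

end Ambient

end Border

/-! ### Forms in charts -/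

theorem eventually_chart {E M : Type*} [TopologicalSpace E] [TopologicalSpace M] {V : Set M} (hV : IsOpen V) {e : OpenPartialHomeomorph M E} {y : E}
    (hy : y ∈ e.target) (hyV : e.symm y ∈ V) : ∀ᶠ z in 𝓝 y, z ∈ e.target ∧ e.symm z ∈ V :=
  (e.symm.isOpen_inter_preimage hV).mem_nhds (show y ∈ e.target ∩ e.symm ⁻¹' V from ⟨hy, hyV⟩)

section Charts

variable {E : Type*} [NormedAddCommGroup E] [NormedSpace ℝ E]
  {M : Type*} [TopologicalSpace M] [ChartedSpace E M]

instance [FiniteDimensional ℝ E] (p : M) : FiniteDimensional ℝ (Tan E p) :=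
  inferInstanceAs (FiniteDimensional ℝ E)

instance (p : M) : T2Space (Tan E p) := inferInstanceAs (T2Space E)

/-- The derivative of the inverse of the chart `e`. -/
noncomputable def chartFrame (e : OpenPartialHomeomorph M E) (y : E) : E →L[ℝ] Tan E (e.symm y) :=
  mfderiv 𝓘(ℝ, E) 𝓘(ℝ, E) e.symm y

theorem wedge_compContinuousLinearMap {V V' : Type*} [AddCommGroup V] [Module ℝ V]
    [TopologicalSpace V] [AddCommGroup V'] [Module ℝ V'] [TopologicalSpace V']
    (a b : V [⋀^Fin 1]→L[ℝ] ℝ) (L : V' →L[ℝ] V) :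
    (wedge a b).compContinuousLinearMap L =
      wedge (a.compContinuousLinearMap L) (b.compContinuousLinearMap L) := by
  have e1 (c : V [⋀^Fin 1]→L[ℝ] ℝ) (u : V') : c.compContinuousLinearMap L ![u] = c ![L u] := by
    change c (fun i => L (![u] i)) = _
    congr 1
    ext i; fin_cases i; rfl
  ext v
  change a ![L (v 0)] * b ![L (v 1)] - a ![L (v 1)] * b ![L (v 0)] =
    a.compContinuousLinearMap L ![v 0] * b.compContinuousLinearMap L ![v 1] -
      a.compContinuousLinearMap L ![v 1] * b.compContinuousLinearMap L ![v 0]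
  simp only [e1]

theorem DForm.SmoothOn.contDiffAt {k : ℕ} {Ω : DForm E M k} {V : Set M} (hV : IsOpen V)
    (h : Ω.SmoothOn V) {e : OpenPartialHomeomorph M E} (he : e ∈ atlas E M) {y : E}
    (hy : y ∈ e.target) (hyV : e.symm y ∈ V) : ContDiffAt ℝ ∞ (Ω.inChart e) y :=
  (h e he).contDiffAt
    ((e.symm.isOpen_inter_preimage hV).mem_nhds (show y ∈ e.target ∩ e.symm ⁻¹' V from ⟨hy, hyV⟩))

theorem DForm.inChart_congr {k : ℕ} {Ω Ω' : DForm E M k} {e : OpenPartialHomeomorph M E} {y : E}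
    (h : Ω (e.symm y) = Ω' (e.symm y)) : Ω.inChart e y = Ω'.inChart e y := by
  simp only [DForm.inChart, h]

/-- The 2-form `g dx ∧ α + β`. -/
noncomputable def conormalForm (x g : M → ℝ) (α : DForm E M 1) (β : DForm E M 2) : DForm E M 2 :=
  fun p => wedge (g p • diff x p) (α p) + β p

theorem conormalForm_apply (x g : M → ℝ) (α : DForm E M 1) (β : DForm E M 2) (p : M)
    (u w : Tan E p) : conormalForm x g α β p ![u, w] =
      g p * (dAt x p u * α p ![w] - dAt x p w * α p ![u]) + β p ![u, w] := by
  change g p * dAt x p u * α p ![w] - g p * dAt x p w * α p ![u] + β p ![u, w] = _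
  ring

theorem conormalForm_apply_inv (x g : M → ℝ) (α : DForm E M 1) (β : DForm E M 2) (p : M)
    (u w : Tan E p) : conormalForm x g α β p ![u, w] =
      (g p)⁻¹⁻¹ * (dAt x p u * α p ![w] - dAt x p w * α p ![u]) + β p ![u, w] := by
  rw [conormalForm_apply, inv_inv]

theorem mem_BTan {x : M → ℝ} {m : ℕ} {p : M} (u : Tan E p × ℝ) :
    u ∈ BTan (E := E) x m p ↔ dAt x p u.1 = x p ^ m * u.2 := Iff.rfl

theorem ofForms_apply (x : M → ℝ) (m : ℕ) (α : DForm E M 1) (β : DForm E M 2) (p : M)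
    (u w : BTan (E := E) x m p) : BForm.ofForms x m α β p ![u, w] =
      u.1.2 * α p ![w.1.1] - w.1.2 * α p ![u.1.1] + β p ![u.1.1, w.1.1] := by
  have e1 (u : BTan (E := E) x m p) :
      (α p).compContinuousLinearMap (anchor x m p) ![u] = α p ![u.1.1] := by
    change α p (fun i => anchor x m p (![u] i)) = _
    congr 1
    ext i; fin_cases i; rfl
  have e2 : (β p).compContinuousLinearMap (anchor x m p) ![u, w] = β p ![u.1.1, w.1.1] := by
    change β p (fun i => anchor x m p (![u, w] i)) = _
    congr 1
    ext i; fin_cases i <;> rfl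
  rw [← e1, ← e1, ← e2]
  rfl

variable [IsManifold 𝓘(ℝ, E) ∞ M]

theorem contMDiffAt_chart_symm {e : OpenPartialHomeomorph M E} (he : e ∈ atlas E M) {y : E}
    (hy : y ∈ e.target) : ContMDiffAt 𝓘(ℝ, E) 𝓘(ℝ, E) ∞ e.symm y :=
  (contMDiffOn_symm_of_mem_maximalAtlas (IsManifold.subset_maximalAtlas he)).contMDiffAt
    (e.open_target.mem_nhds hy)

theorem mdifferentiable_chart {e : OpenPartialHomeomorph M E} (he : e ∈ atlas E M) :
    e.MDifferentiable 𝓘(ℝ, E) 𝓘(ℝ, E) :=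
  haveI : IsManifold 𝓘(ℝ, E) 1 M := IsManifold.of_le (n := ∞) (by simp)
  mdifferentiable_of_mem_atlas he

theorem chartFrame_bijective {e : OpenPartialHomeomorph M E} (he : e ∈ atlas E M) {y : E}
    (hy : y ∈ e.target) : Function.Bijective (chartFrame e y) :=
  (mdifferentiable_chart he).symm.mfderiv_bijective hy

theorem chartCovector_chartFrame {e : OpenPartialHomeomorph M E} {y : E} (he : e ∈ atlas E M) (hy : y ∈ e.target) (ξ : Module.Dual ℝ E)
    (v : E) : chartCovector e ξ (e.symm y) (chartFrame e y v) = ξ v := by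
  have h := (mdifferentiable_chart he).comp_symm_deriv hy
  exact congrArg ξ (DFunLike.congr_fun h v)

theorem contDiffAt_comp_chart_symm {F : Type*} [NormedAddCommGroup F] [NormedSpace ℝ F] {g : M → F}
    {e : OpenPartialHomeomorph M E} (he : e ∈ atlas E M) {y : E} (hy : y ∈ e.target)
    (hg : ContMDiffAt 𝓘(ℝ, E) 𝓘(ℝ, F) ∞ g (e.symm y)) : ContDiffAt ℝ ∞ (fun z => g (e.symm z)) y :=
  contMDiffAt_iff_contDiffAt.1 (hg.comp y (contMDiffAt_chart_symm he hy))

theorem dAt_comp_chart_symm {g : M → ℝ} {e : OpenPartialHomeomorph M E} (he : e ∈ atlas E M) {y : E}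
    (hy : y ∈ e.target) (hg : MDifferentiableAt 𝓘(ℝ, E) 𝓘(ℝ, ℝ) g (e.symm y)) :
    (dAt g (e.symm y)).comp (chartFrame e y) =
      fderiv ℝ (fun z => g (e.symm z)) y := by
  have h := mfderiv_comp y hg ((contMDiffAt_chart_symm he hy).mdifferentiableAt (by simp))
  rw [mfderiv_eq_fderiv] at h
  exact h.symm

theorem diff_inChart {g : M → ℝ} {e : OpenPartialHomeomorph M E} (he : e ∈ atlas E M) {y : E}
    (hy : y ∈ e.target) (hg : MDifferentiableAt 𝓘(ℝ, E) 𝓘(ℝ, ℝ) g (e.symm y)) :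
    (diff g).inChart e y =
      ContinuousAlternatingMap.ofSubsingleton ℝ E ℝ (0 : Fin 1)
        (fderiv ℝ (fun z => g (e.symm z)) y) := by
  rw [← dAt_comp_chart_symm he hy hg]
  rfl

theorem conormalForm_inChart {x : M → ℝ} (g : M → ℝ) (α : DForm E M 1) (β : DForm E M 2)
    {e : OpenPartialHomeomorph M E} (he : e ∈ atlas E M) {y : E} (hy : y ∈ e.target)
    (hx : MDifferentiableAt 𝓘(ℝ, E) 𝓘(ℝ, ℝ) x (e.symm y)) :
    (conormalForm x g α β).inChart e y =
      wedge (g (e.symm y) • ContinuousAlternatingMap.ofSubsingleton ℝ E ℝ (0 : Fin 1)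
        (fderiv ℝ (fun z => x (e.symm z)) y)) (α.inChart e y) + β.inChart e y := by
  rw [← diff_inChart he hy hx]
  change (wedge (g (e.symm y) • diff x (e.symm y)) (α (e.symm y))).compContinuousLinearMap
    (chartFrame e y) + β.inChart e y = _
  rw [wedge_compContinuousLinearMap]
  rfl

theorem contDiffAt_fderiv_comp_chart_symm {x : M → ℝ} (hx : ContMDiff 𝓘(ℝ, E) 𝓘(ℝ, ℝ) ∞ x)
    {e : OpenPartialHomeomorph M E} (he : e ∈ atlas E M) {y : E} (hy : y ∈ e.target) :
    ContDiffAt ℝ ∞ (fderiv ℝ (fun z => x (e.symm z))) y :=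
  (contDiffAt_comp_chart_symm he hy hx.contMDiffAt).fderiv_right (m := ∞) (by simp)

theorem contDiffAt_conormalForm_inChart [FiniteDimensional ℝ E] {x g : M → ℝ} {α : DForm E M 1}
    {β : DForm E M 2} (hx : ContMDiff 𝓘(ℝ, E) 𝓘(ℝ, ℝ) ∞ x)
    {e : OpenPartialHomeomorph M E} (he : e ∈ atlas E M) {y : E} (hy : y ∈ e.target)
    (hg : ContDiffAt ℝ ∞ (fun z => g (e.symm z)) y)
    (hα : ContDiffAt ℝ ∞ (α.inChart e) y) (hβ : ContDiffAt ℝ ∞ (β.inChart e) y) :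
    ContDiffAt ℝ ∞ ((conormalForm x g α β).inChart e) y := by
  have h : (conormalForm x g α β).inChart e =ᶠ[𝓝 y] fun y =>
      wedge (g (e.symm y) • ContinuousAlternatingMap.ofSubsingleton ℝ E ℝ (0 : Fin 1)
        (fderiv ℝ (fun z => x (e.symm z)) y)) (α.inChart e y) + β.inChart e y := by
    filter_upwards [e.open_target.mem_nhds hy] with z hz
    exact conormalForm_inChart g α β he hz (hx.mdifferentiableAt (by simp))
  refine ContDiffAt.congr_of_eventuallyEq ?_ h
  exact ((hg.smul (contDiffAt_fderiv_comp_chart_symm hx he hy).ofSubsingleton).wedge hα).add hβ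

/-! ### Dual bivectors in charts -/

variable [FiniteDimensional ℝ E]

/-- The bordered system of `μ⁻¹ dx ∧ α + β` at the point with coordinates `y` in the chart `e`. -/
noncomputable def chartBorder (x : M → ℝ) (α : DForm E M 1) (β : DForm E M 2)
    (e : OpenPartialHomeomorph M E) (y : E) (μ : ℝ) : E × ℝ × ℝ →L[ℝ] (E →L[ℝ] ℝ) × ℝ × ℝ :=
  border (fderiv ℝ (fun z => x (e.symm z)) y) (α.inChart e y) (β.inChart e y) μ

/-- The coefficient in the chart `e` of the bivector dual to `μ⁻¹ dx ∧ α + β`. -/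
noncomputable def chartDual (x : M → ℝ) (α : DForm E M 1) (β : DForm E M 2)
    (e : OpenPartialHomeomorph M E) (ξ η : Module.Dual ℝ E) (y : E) (μ : ℝ) : ℝ :=
  - η ((chartBorder x α β e y μ).inverse (LinearMap.toContinuousLinearMap ξ, 0, 0)).1

variable {x : M → ℝ} {α : DForm E M 1} {β : DForm E M 2} {e : OpenPartialHomeomorph M E} {y : E}
  {μ : ℝ}

theorem chartBorder_eq (hx : ContMDiff 𝓘(ℝ, E) 𝓘(ℝ, ℝ) ∞ x) (he : e ∈ atlas E M)
    (hy : y ∈ e.target) (μ : ℝ) : chartBorder x α β e y μ =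
      borderVia (V := Tan E (e.symm y)) (chartFrame e y) (dAt x (e.symm y))
        (α (e.symm y)) (β (e.symm y)) μ := by
  rw [chartBorder, ← dAt_comp_chart_symm he hy (hx.mdifferentiableAt (by simp))]
  rfl

theorem isInvertible_chartBorder (hx : ContMDiff 𝓘(ℝ, E) 𝓘(ℝ, ℝ) ∞ x) (he : e ∈ atlas E M)
    (hy : y ∈ e.target)
    (h : Function.Injective (borderVia (V := Tan E (e.symm y)) (chartFrame e y)
      (dAt x (e.symm y)) (α (e.symm y)) (β (e.symm y)) μ)) :
    (chartBorder x α β e y μ).IsInvertible := by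
  rw [← chartBorder_eq hx he hy] at h
  exact isInvertible_border h

/-- Passes from coordinates to the tangent space at the point. The same solution feeds both duality
computations, `coeff_dualBivector` and `coeff_poisson`, so that both bivectors are expressed by
`chartDual`. -/
theorem exists_borderVia_solution (hx : ContMDiff 𝓘(ℝ, E) 𝓘(ℝ, ℝ) ∞ x) (he : e ∈ atlas E M)
    (hy : y ∈ e.target) (hinv : (chartBorder x α β e y μ).IsInvertible) (ξ : Module.Dual ℝ E) :
    borderVia (V := Tan E (e.symm y)) (chartFrame e y) (dAt x (e.symm y))
        (α (e.symm y)) (β (e.symm y)) μ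
        ((chartBorder x α β e y μ).inverse (LinearMap.toContinuousLinearMap ξ, 0, 0)) =
      ((LinearMap.toContinuousLinearMap (chartCovector e ξ (e.symm y))).comp
        (chartFrame e y), 0, 0) := by
  rw [← chartBorder_eq hx he hy]
  refine (hinv.self_apply_inverse _).trans ?_
  refine Prod.ext (ContinuousLinearMap.ext fun v => ?_) rfl
  exact (chartCovector_chartFrame he hy ξ v).symm

theorem nondegenerate_conormalForm {g : M → ℝ} (hx : ContMDiff 𝓘(ℝ, E) 𝓘(ℝ, ℝ) ∞ x)
    (he : e ∈ atlas E M) (hy : y ∈ e.target) (hg : g (e.symm y) ≠ 0)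
    (hinv : (chartBorder x α β e y (g (e.symm y))⁻¹).IsInvertible) :
    Nondegenerate (conormalForm x g α β (e.symm y)) := by
  refine nondegenerate_of_borderVia_injective (L := chartFrame e y)
    (chartFrame_bijective he hy).2 (inv_ne_zero hg)
    (hΩ := conormalForm_apply_inv x g α β (e.symm y)) ?_
  rw [← chartBorder_eq hx he hy]
  exact hinv.injective

theorem isInvertible_chartBorder_of_conormalForm {g : M → ℝ}
    (hx : ContMDiff 𝓘(ℝ, E) 𝓘(ℝ, ℝ) ∞ x) (he : e ∈ atlas E M) (hy : y ∈ e.target)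
    (hg : g (e.symm y) ≠ 0) (hnd : Nondegenerate (conormalForm x g α β (e.symm y))) :
    (chartBorder x α β e y (g (e.symm y))⁻¹).IsInvertible :=
  isInvertible_chartBorder hx he hy <|
    borderVia_injective_of_nondegenerate' (chartFrame_bijective he hy) (inv_ne_zero hg)
    (hΩ := conormalForm_apply_inv x g α β (e.symm y)) hnd

theorem coeff_dualBivector {g : M → ℝ} {Ω : DForm E M 2} (hx : ContMDiff 𝓘(ℝ, E) 𝓘(ℝ, ℝ) ∞ x)
    (he : e ∈ atlas E M) (hy : y ∈ e.target) (hg : g (e.symm y) ≠ 0)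
    (hΩ : Ω (e.symm y) = conormalForm x g α β (e.symm y))
    (hinv : (chartBorder x α β e y (g (e.symm y))⁻¹).IsInvertible) (ξ η : Module.Dual ℝ E) :
    BivectorField.coeff (fun p => dualBivector (Ω p)) e ξ η y =
      chartDual x α β e ξ η y (g (e.symm y))⁻¹ := by
  have h := dualBivector_eq_of_borderVia_eq (Ω := conormalForm x g α β (e.symm y)) (chartFrame_bijective he hy).2
    (inv_ne_zero hg) (hΩ := conormalForm_apply_inv x g α β (e.symm y))
    (nondegenerate_conormalForm hx he hy hg hinv)
    (exists_borderVia_solution hx he hy hinv ξ) (chartCovector e η (e.symm y))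
  rw [chartCovector_chartFrame he hy] at h
  rw [BivectorField.coeff, hΩ]
  exact h

variable {m : ℕ} {Ω : BForm E x m}

theorem isInvertible_chartBorder_of_bform (hx : ContMDiff 𝓘(ℝ, E) 𝓘(ℝ, ℝ) ∞ x)
    (hreg : ∀ p : M, x p = 0 → mfderiv 𝓘(ℝ, E) 𝓘(ℝ, ℝ) x p ≠ 0)
    (he : e ∈ atlas E M) (hy : y ∈ e.target)
    (hΩ : Ω (e.symm y) = BForm.ofForms x m α β (e.symm y)) (hnd : Nondegenerate (Ω (e.symm y))) :
    (chartBorder x α β e y (x (e.symm y) ^ m)).IsInvertible :=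
  isInvertible_chartBorder hx he hy <|
    borderVia_injective_of_nondegenerate (chartFrame_bijective he hy)
      (fun u => mem_BTan u) (fun u w => by rw [hΩ, ofForms_apply])
      -- The parameter `x^m` can vanish only on `Z`, where `dx ≠ 0` because `0` is a regular value.
      (fun h0 => hreg _ (eq_zero_of_pow_eq_zero h0)) hnd

theorem coeff_poisson (hx : ContMDiff 𝓘(ℝ, E) 𝓘(ℝ, ℝ) ∞ x)
    (hreg : ∀ p : M, x p = 0 → mfderiv 𝓘(ℝ, E) 𝓘(ℝ, ℝ) x p ≠ 0)
    (he : e ∈ atlas E M) (hy : y ∈ e.target)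
    (hΩ : Ω (e.symm y) = BForm.ofForms x m α β (e.symm y)) (hnd : Nondegenerate (Ω (e.symm y)))
    (ξ η : Module.Dual ℝ E) :
    Ω.poisson.coeff e ξ η y = chartDual x α β e ξ η y (x (e.symm y) ^ m) := by
  have hinv := isInvertible_chartBorder_of_bform hx hreg he hy hΩ hnd
  have h := dualBivector_eq_of_borderVia_eq_submodule (chartFrame_bijective he hy).2
    (fun u => mem_BTan u) (fun u w => by rw [hΩ, ofForms_apply]) hnd
    (exists_borderVia_solution hx he hy hinv ξ)
    (ζ := Module.Dual.transpose (R := ℝ) (anchor (E := E) x m (e.symm y)).toLinearMap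
      (chartCovector e ξ (e.symm y)))
    (ζ' := Module.Dual.transpose (R := ℝ) (anchor (E := E) x m (e.symm y)).toLinearMap
      (chartCovector e η (e.symm y)))
    (hζ := fun w => rfl) (θ := chartCovector e η (e.symm y)) (hζ' := fun w => rfl)
  rw [chartCovector_chartFrame he hy] at h
  refine Eq.trans ?_ h
  change dualBivector (Ω (e.symm y)) (fun i => _) = _
  congr 1
  ext i; fin_cases i <;> rfl

end Charts

/-! ### Exterior derivatives -/

section ExtDeriv

theorem minSmoothness_two_le_infty : minSmoothness ℝ 2 ≤ ∞ := by
  rw [minSmoothness_of_isRCLikeNormedField]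
  exact WithTop.coe_le_coe.2 (le_top : (2 : ℕ∞) ≤ ⊤)

theorem exists_contDiff_antideriv {φ : ℝ → ℝ} (hφ : ContDiff ℝ ∞ φ) :
    ∃ h : ℝ → ℝ, ContDiff ℝ ∞ h ∧ deriv h = φ := by
  have hd (t : ℝ) : HasDerivAt (fun u => ∫ s in (0 : ℝ)..u, φ s) (φ t) t :=
    hφ.continuous.integral_hasStrictDerivAt 0 t |>.hasDerivAt
  have he : deriv (fun u => ∫ s in (0 : ℝ)..u, φ s) = φ := funext fun t => (hd t).deriv
  exact ⟨_, contDiff_infty_iff_deriv.2 ⟨fun t => (hd t).differentiableAt, by rwa [he]⟩, he⟩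

variable {E : Type*} [NormedAddCommGroup E] [NormedSpace ℝ E]

theorem extDeriv_fun_smul_form {g : E → ℝ} {a : E → E [⋀^Fin 1]→L[ℝ] ℝ} {y : E}
    (hg : DifferentiableAt ℝ g y) (ha : DifferentiableAt ℝ a y) :
    extDeriv (fun z => g z • a z) y =
      wedge (ContinuousAlternatingMap.ofSubsingleton ℝ E ℝ (0 : Fin 1) (fderiv ℝ g y)) (a y)
        + g y • extDeriv a y := by
  ext v
  have hav (w : Fin 1 → E) : DifferentiableAt ℝ (fun z => a z w) y :=
    (ContinuousAlternatingMap.apply ℝ E ℝ w).differentiableAt.comp y ha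
  have hm (w : Fin 1 → E) (u : E) : fderiv ℝ (fun z => (g z • a z) w) y u =
      g y * fderiv ℝ (fun z => a z w) y u + a y w * fderiv ℝ g y u := by
    change fderiv ℝ (fun z => g z * a z w) y u = _
    rw [fderiv_fun_mul hg (hav w)]
    rfl
  have e0 : (0 : Fin 2).removeNth v = ![v 1] := by ext i; fin_cases i; rfl
  have e1 : (1 : Fin 2).removeNth v = ![v 0] := by ext i; fin_cases i; rfl
  change _ = fderiv ℝ g y (v 0) * a y ![v 1] - fderiv ℝ g y (v 1) * a y ![v 0] +
    g y * extDeriv a y v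
  rw [extDeriv_apply (hg.fun_smul ha), extDeriv_apply ha, Fin.sum_univ_two, Fin.sum_univ_two, hm, hm,
    e0, e1]
  simp only [Fin.val_zero, Fin.val_one, pow_zero, pow_one]
  ring

theorem _root_.ContDiffAt.extDeriv {n : ℕ} {a : E → E [⋀^Fin n]→L[ℝ] ℝ} {y : E}
    (ha : ContDiffAt ℝ ∞ a y) : ContDiffAt ℝ ∞ (extDeriv a) y := by
  have h : ContDiffAt ℝ ∞ (fderiv ℝ a) y := ha.fderiv_right (m := ∞) (by simp)
  exact (ContinuousAlternatingMap.alternatizeUncurryFinCLM ℝ E ℝ (n := n)).contDiff.contDiffAt.comp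
    y h

theorem extDeriv_fun_sum {ι : Type*} {n : ℕ} (s : Finset ι) {a : ι → E → E [⋀^Fin n]→L[ℝ] ℝ} {y : E}
    (ha : ∀ i ∈ s, DifferentiableAt ℝ (a i) y) :
    extDeriv (fun z => ∑ i ∈ s, a i z) y = ∑ i ∈ s, extDeriv (a i) y := by
  rw [extDeriv, fderiv_fun_sum ha]
  exact map_sum (ContinuousAlternatingMap.alternatizeUncurryFinCLM ℝ E ℝ) _ _

theorem wedge_smul_sum {V : Type*} [AddCommGroup V] [Module ℝ V] [TopologicalSpace V] {ι : Type*}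
    (s : Finset ι) (c : ℝ) (d : ι → ℝ) (b : V [⋀^Fin 1]→L[ℝ] ℝ) (a : ι → V [⋀^Fin 1]→L[ℝ] ℝ) :
    wedge (c • b) (∑ i ∈ s, d i • a i) = ∑ i ∈ s, wedge ((c * d i) • b) (a i) := by
  ext v
  have h (w : Fin 1 → V) : (∑ i ∈ s, d i • a i) w = ∑ i ∈ s, d i * a i w := by
    simp [ContinuousAlternatingMap.sum_apply]
  rw [ContinuousAlternatingMap.sum_apply]
  change c * b ![v 0] * (∑ i ∈ s, d i • a i) ![v 1] - c * b ![v 1] * (∑ i ∈ s, d i • a i) ![v 0] =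
    ∑ i ∈ s, (c * d i * b ![v 0] * a i ![v 1] - c * d i * b ![v 1] * a i ![v 0])
  rw [h, h, Finset.mul_sum, Finset.mul_sum, ← Finset.sum_sub_distrib]
  exact Finset.sum_congr rfl fun i _ => by ring

end ExtDeriv

/-! ### Pullbacks and Laurent sums in charts -/

section Pullback

variable {E : Type*} [NormedAddCommGroup E] [NormedSpace ℝ E]
  {F : Type*} [NormedAddCommGroup F] [NormedSpace ℝ F]
  {M : Type*} [TopologicalSpace M] [ChartedSpace E M]
  {N : Type*} [TopologicalSpace N] [ChartedSpace F N]

theorem laurentSum_inChart {m : ℕ} (x : M → ℝ) (π : M → N) (a : Fin m → DForm F N 1)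
    (e : OpenPartialHomeomorph M E) (y : E) :
    (laurentSum x π a).inChart e y =
      ∑ i : Fin m, x (e.symm y) ^ (i : ℕ) • (DForm.pullback (E := E) π (a i)).inChart e y := by
  ext v
  change (∑ i : Fin m, x (e.symm y) ^ (i : ℕ) • DForm.pullback (E := E) π (a i) (e.symm y))
    (fun i => chartFrame e y (v i)) = _
  rw [ContinuousAlternatingMap.sum_apply, ContinuousAlternatingMap.sum_apply]
  rfl

variable [IsManifold 𝓘(ℝ, E) ∞ M]

/-- The pullback of a differential form on `N` to the vector space `E`. -/
noncomputable def pullbackToSpace {k : ℕ} (a : DForm F N k) (g : E → N) (y : E) :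
    E [⋀^Fin k]→L[ℝ] ℝ :=
  (a (g y)).compContinuousLinearMap (mfderiv 𝓘(ℝ, E) 𝓘(ℝ, F) g y)

theorem pullbackToSpace_congr {k : ℕ} {a : DForm F N k} {g g' : E → N} {y : E}
    (h : g =ᶠ[𝓝 y] g') : pullbackToSpace a g y = pullbackToSpace a g' y := by
  -- All tangent spaces of `N` are definitionally `F`. Forgetting the base points in the types
  -- allows `g y` to be rewritten to `g' y`.
  let A : N → F [⋀^Fin k]→L[ℝ] ℝ := a
  let T : E →L[ℝ] F := mfderiv 𝓘(ℝ, E) 𝓘(ℝ, F) g y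
  let T' : E →L[ℝ] F := mfderiv 𝓘(ℝ, E) 𝓘(ℝ, F) g' y
  have hT : T = T' := h.mfderiv_eq
  change (A (g y)).compContinuousLinearMap T = (A (g' y)).compContinuousLinearMap T'
  rw [hT, h.eq_of_nhds]

theorem pullback_inChart_eq {k : ℕ} {a : DForm F N k} {π : M → N}
    {e : OpenPartialHomeomorph M E} (he : e ∈ atlas E M) {y : E} (hy : y ∈ e.target)
    (hπ : MDifferentiableAt 𝓘(ℝ, E) 𝓘(ℝ, F) π (e.symm y)) :
    (DForm.pullback π a).inChart e y = pullbackToSpace a (fun z => π (e.symm z)) y := by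
  have h := mfderiv_comp y hπ ((contMDiffAt_chart_symm he hy).mdifferentiableAt (by simp))
  let T : E →L[ℝ] Tan F (π (e.symm y)) :=
    (mfderiv 𝓘(ℝ, E) 𝓘(ℝ, F) π (e.symm y)).comp (chartFrame e y)
  let T' : E →L[ℝ] Tan F (π (e.symm y)) := mfderiv 𝓘(ℝ, E) 𝓘(ℝ, F) (fun z => π (e.symm z)) y
  have hT : T' = T := h
  change (a (π (e.symm y))).compContinuousLinearMap T = (a (π (e.symm y))).compContinuousLinearMap T'
  rw [hT]

variable [IsManifold 𝓘(ℝ, F) ∞ N]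

theorem pullbackToSpace_chart_symm {k : ℕ} {a : DForm F N k} {e : OpenPartialHomeomorph N F}
    (he : e ∈ atlas F N) {g : E → F} {y : E} (hg : DifferentiableAt ℝ g y) (hy : g y ∈ e.target) :
    pullbackToSpace a (fun z => e.symm (g z)) y =
      (a.inChart e (g y)).compContinuousLinearMap (fderiv ℝ g y) := by
  have h := mfderiv_comp y ((contMDiffAt_chart_symm he hy).mdifferentiableAt (by simp))
    hg.mdifferentiableAt
  let T : E →L[ℝ] Tan F (e.symm (g y)) := (chartFrame e (g y)).comp (fderiv ℝ g y)
  let T' : E →L[ℝ] Tan F (e.symm (g y)) := mfderiv 𝓘(ℝ, E) 𝓘(ℝ, F) (fun z => e.symm (g z)) y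
  have hT : T' = T := by
    rw [mfderiv_eq_fderiv] at h
    exact h
  change (a (e.symm (g y))).compContinuousLinearMap T' =
    (a (e.symm (g y))).compContinuousLinearMap T
  rw [hT]

variable {U : Set M} {π : M → N}

/-- In charts, the pullback of a form by a smooth map is the pullback by the smooth map `g` of
vector spaces that represents it. -/
theorem exists_pullback_inChart_eventuallyEq (hU : IsOpen U)
    (hπ : ContMDiffOn 𝓘(ℝ, E) 𝓘(ℝ, F) ∞ π U) {e : OpenPartialHomeomorph M E} (he : e ∈ atlas E M)
    {y : E} (hy : y ∈ e.target) (hyU : e.symm y ∈ U) {k : ℕ} (a : DForm F N k) :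
    ∃ e' ∈ atlas F N, ∃ g : E → F, ContDiffAt ℝ ∞ g y ∧ g y ∈ e'.target ∧
      (DForm.pullback π a).inChart e =ᶠ[𝓝 y]
        fun z => (a.inChart e' (g z)).compContinuousLinearMap (fderiv ℝ g z) := by
  let e' := chartAt F (π (e.symm y))
  have hπ' : ContMDiffAt 𝓘(ℝ, E) 𝓘(ℝ, F) ∞ (fun z => π (e.symm z)) y :=
    (hπ.contMDiffAt (hU.mem_nhds hyU)).comp y (contMDiffAt_chart_symm he hy)
  have hsrc : π (e.symm y) ∈ e'.source := mem_chart_source F _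
  have hg : ContDiffAt ℝ ∞ (fun z => e' (π (e.symm z))) y :=
    contMDiffAt_iff_contDiffAt.1 <|
      ((contMDiffOn_of_mem_maximalAtlas
        (IsManifold.subset_maximalAtlas (chart_mem_atlas F _))).contMDiffAt
          (e'.open_source.mem_nhds hsrc)).comp y hπ'
  refine ⟨e', chart_mem_atlas F _, fun z => e' (π (e.symm z)), hg, e'.map_source hsrc, ?_⟩
  have h1 := eventually_chart hU hy hyU
  have h2 : ∀ᶠ z in 𝓝 y, π (e.symm z) ∈ e'.source :=
    hπ'.continuousAt.eventually (e'.open_source.mem_nhds hsrc)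
  have h3 : ∀ᶠ z in 𝓝 y, DifferentiableAt ℝ (fun z => e' (π (e.symm z))) z :=
    ((hg.of_le (m := 1) (by simp)).eventually (by simp)).mono fun z hz =>
      hz.differentiableAt (by simp)
  filter_upwards [h1, h2.eventually_nhds, h3] with z hz hz2 hz3
  rw [pullback_inChart_eq he hz.1 ((hπ.contMDiffAt (hU.mem_nhds hz.2)).mdifferentiableAt (by simp)),
    ← pullbackToSpace_chart_symm (chart_mem_atlas F _) hz3 (e'.map_source hz2.self_of_nhds)]
  exact pullbackToSpace_congr (hz2.mono fun w hw => (e'.left_inv hw).symm)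

/-- Naturality of `d`, applied to the local representative of `π` in charts. -/
theorem extDeriv_pullback_inChart (hU : IsOpen U)
    (hπ : ContMDiffOn 𝓘(ℝ, E) 𝓘(ℝ, F) ∞ π U) {e : OpenPartialHomeomorph M E} (he : e ∈ atlas E M)
    {y : E} (hy : y ∈ e.target) (hyU : e.symm y ∈ U) {k : ℕ} {a : DForm F N k}
    (ha : a.SmoothOn Set.univ) (hc : a.ClosedOn Set.univ) :
    extDeriv ((DForm.pullback π a).inChart e) y = 0 := by
  obtain ⟨e', he', g, hg, hgy, h⟩ := exists_pullback_inChart_eventuallyEq hU hπ he hy hyU a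
  rw [h.extDeriv_eq, extDeriv_pullback
    ((ha.contDiffAt isOpen_univ he' hgy trivial).differentiableAt (by simp)) hg minSmoothness_two_le_infty,
    hc e' he' _ ⟨hgy, trivial⟩]
  rfl

variable [FiniteDimensional ℝ E] [FiniteDimensional ℝ F]

theorem contDiffAt_pullback_inChart (hU : IsOpen U)
    (hπ : ContMDiffOn 𝓘(ℝ, E) 𝓘(ℝ, F) ∞ π U) {e : OpenPartialHomeomorph M E} (he : e ∈ atlas E M)
    {y : E} (hy : y ∈ e.target) (hyU : e.symm y ∈ U) {k : ℕ} {a : DForm F N k}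
    (ha : a.SmoothOn Set.univ) : ContDiffAt ℝ ∞ ((DForm.pullback π a).inChart e) y := by
  obtain ⟨e', he', g, hg, hgy, h⟩ := exists_pullback_inChart_eventuallyEq hU hπ he hy hyU a
  refine ContDiffAt.congr_of_eventuallyEq ?_ h
  exact ((ha.contDiffAt isOpen_univ he' hgy trivial).comp y hg).form_compContinuousLinearMap
    (hg.fderiv_right (m := ∞) (by simp))

variable {x : M → ℝ} {m : ℕ} {a : Fin m → DForm F N 1}

theorem contDiffAt_laurentSum_inChart (hx : ContMDiff 𝓘(ℝ, E) 𝓘(ℝ, ℝ) ∞ x) (hU : IsOpen U)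
    (hπ : ContMDiffOn 𝓘(ℝ, E) 𝓘(ℝ, F) ∞ π U) {e : OpenPartialHomeomorph M E} (he : e ∈ atlas E M)
    {y : E} (hy : y ∈ e.target) (hyU : e.symm y ∈ U) (ha : ∀ i, (a i).SmoothOn Set.univ) :
    ContDiffAt ℝ ∞ ((laurentSum x π a).inChart e) y := by
  rw [show (laurentSum x π a).inChart e = _ from funext fun z => laurentSum_inChart x π a e z]
  exact ContDiffAt.sum fun i _ =>
    ((contDiffAt_comp_chart_symm he hy hx.contMDiffAt).pow _).smul
      (contDiffAt_pullback_inChart hU hπ he hy hyU (ha i))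

/-- The form `γ(x) dx ∧ ∑ x ^ i π^* a_i` is closed when the `a_i` are. -/
theorem extDeriv_conormalForm_laurentSum (hx : ContMDiff 𝓘(ℝ, E) 𝓘(ℝ, ℝ) ∞ x) (hU : IsOpen U)
    (hπ : ContMDiffOn 𝓘(ℝ, E) 𝓘(ℝ, F) ∞ π U) {e : OpenPartialHomeomorph M E} (he : e ∈ atlas E M)
    {y : E} (hy : y ∈ e.target) (hyU : e.symm y ∈ U) (ha : ∀ i, (a i).SmoothOn Set.univ)
    (hc : ∀ i, (a i).ClosedOn Set.univ) {γ : ℝ → ℝ} (hγ : ContDiff ℝ ∞ γ) {β : DForm E M 2}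
    (hβ : ContDiffAt ℝ ∞ (β.inChart e) y) :
    extDeriv ((conormalForm x (fun p => γ (x p)) (laurentSum x π a) β).inChart e) y =
      extDeriv (β.inChart e) y := by
  -- With `h_i' = γ t^i`, the form `θ = ∑ h_i(x) π^* a_i` is a local primitive of the part
  -- containing `dx`: the terms `h_i(x) d(π^* a_i)` vanish.
  choose h hh hd using fun i : Fin m =>
    exists_contDiff_antideriv (hγ.mul (contDiff_id.pow (i : ℕ)))
  let b (i : Fin m) : E → E [⋀^Fin 1]→L[ℝ] ℝ := (DForm.pullback (E := E) π (a i)).inChart e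
  let θ (z : E) : E [⋀^Fin 1]→L[ℝ] ℝ := ∑ i, h i (x (e.symm z)) • b i z
  have hxe {z : E} (hz : z ∈ e.target) : ContDiffAt ℝ ∞ (fun z => x (e.symm z)) z :=
    contDiffAt_comp_chart_symm he hz hx.contMDiffAt
  have hb (i : Fin m) {z : E} (hz : z ∈ e.target ∧ e.symm z ∈ U) : ContDiffAt ℝ ∞ (b i) z :=
    contDiffAt_pullback_inChart hU hπ he hz.1 hz.2 (ha i)
  have hθ : ContDiffAt ℝ ∞ θ y := ContDiffAt.sum fun i _ =>
    ((hh i).contDiffAt.comp y (hxe hy)).smul (hb i ⟨hy, hyU⟩)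
  have hev : (conormalForm x (fun p => γ (x p)) (laurentSum x π a) β).inChart e =ᶠ[𝓝 y]
      fun z => extDeriv θ z + β.inChart e z := by
    filter_upwards [eventually_chart hU hy hyU] with z hz
    have hxz := (hxe hz.1).differentiableAt (by simp)
    rw [conormalForm_inChart _ _ _ he hz.1 (hx.mdifferentiableAt (by simp)), laurentSum_inChart,
      wedge_smul_sum]
    congr 1
    have hhd (i : Fin m) (t : ℝ) : HasDerivAt (h i) (γ t * t ^ (i : ℕ)) t := by
      have := ((hh i).differentiable (by simp) t).hasDerivAt
      rwa [hd] at this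
    have hhx (i : Fin m) := (hhd i (x (e.symm z))).comp_hasFDerivAt z hxz.hasFDerivAt
    rw [extDeriv_fun_sum (a := fun i w => h i (x (e.symm w)) • b i w) _ fun i _ =>
      (hhx i).differentiableAt.smul ((hb i hz).differentiableAt (by simp))]
    refine Finset.sum_congr rfl fun i _ => ?_
    rw [extDeriv_fun_smul_form (g := fun w => h i (x (e.symm w))) (hhx i).differentiableAt ((hb i hz).differentiableAt (by simp)),
      show fderiv ℝ (fun w => h i (x (e.symm w))) z = _ from (hhx i).fderiv, extDeriv_pullback_inChart hU hπ he hz.1 hz.2 (ha i) (hc i), smul_zero,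
      add_zero]
    rfl
  have hdθ : ContDiffAt ℝ ∞ (extDeriv θ) y := hθ.extDeriv
  rw [hev.extDeriv_eq, extDeriv_fun_add (hdθ.differentiableAt (by simp))
    (hβ.differentiableAt (by simp)), extDeriv_extDeriv_apply hθ minSmoothness_two_le_infty, zero_add]

end Pullback

/-! ### The desingularizing functions -/

section Desingularizer

variable {k : ℕ} {f : ℝ → ℝ}

theorem IsDesingularizer.deriv_eq_of_one_lt (hk : 1 ≤ k) (hf : IsDesingularizer k f) {t : ℝ}
    (ht : 1 < |t|) : deriv f t = (t ^ (2 * k))⁻¹ := by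
  have ht0 : t ≠ 0 := by
    rintro rfl
    simp at ht
    linarith
  have hk' : (2 * (k : ℝ) - 1) ≠ 0 := by
    have : (1 : ℝ) ≤ k := by exact_mod_cast hk
    linarith
  -- An arbitrary constant `c` treats the branches `t > 1` and `t < -1` at once; the shifts by `2`
  -- do not affect the derivative.
  have hmain (c : ℝ) :
      HasDerivAt (fun t : ℝ => -1 / ((2 * (k : ℝ) - 1) * t ^ (2 * k - 1)) + c) (t ^ (2 * k))⁻¹ t := by
    obtain ⟨n, rfl⟩ : ∃ n, k = n + 1 := ⟨k - 1, by omega⟩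
    have hn : 2 * (n + 1) - 1 = 2 * n + 1 := by omega
    rw [hn]
    have hp : HasDerivAt (fun t : ℝ => (2 * ((n + 1 : ℕ) : ℝ) - 1) * t ^ (2 * n + 1))
        ((2 * ((n + 1 : ℕ) : ℝ) - 1) * (((2 * n + 1 : ℕ) : ℝ) * t ^ (2 * n))) t := by
      simpa using (hasDerivAt_pow (2 * n + 1) t).const_mul (2 * ((n + 1 : ℕ) : ℝ) - 1)
    have hq := ((hasDerivAt_const t (-1 : ℝ)).fun_div hp
      (mul_ne_zero hk' (pow_ne_zero _ ht0))).add_const c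
    refine hq.congr_deriv ?_
    have h2 : (2 * (n : ℝ) + 1) ≠ 0 := by positivity
    push_cast
    rw [show 2 * ((n : ℝ) + 1) - 1 = 2 * n + 1 by ring]
    field_simp
    ring
  rcases lt_abs.1 ht with h | h
  · exact (((hmain 2).congr_of_eventuallyEq <| by
      filter_upwards [lt_mem_nhds h] with s hs using hf.eq_right s hs)).deriv
  · exact (((hmain (-2)).congr_of_eventuallyEq <| by
      filter_upwards [gt_mem_nhds (show t < -1 by linarith)] with s hs
      rw [hf.eq_left s hs]
      ring)).deriv

theorem IsDesingularizer.continuous_deriv (hf : IsDesingularizer k f) : Continuous (deriv f) :=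
  hf.smooth.continuous_deriv (by simp)

theorem IsDesingularizer.deriv_eq (hk : 1 ≤ k) (hf : IsDesingularizer k f) {t : ℝ}
    (ht : 1 ≤ |t|) : deriv f t = (t ^ (2 * k))⁻¹ := by
  have ht0 : t ≠ 0 := by
    rintro rfl
    simp at ht
    linarith
  -- The formulas for `f` hold only on `|t| > 1`; the case `|t| = 1` is the limit of `f'(c t)` as
  -- `c` decreases to `1`.
  have h1 : Filter.Tendsto (fun c : ℝ => deriv f (c * t)) (𝓝[>] 1) (𝓝 (deriv f (1 * t))) :=
    (hf.continuous_deriv.comp (continuous_id.mul continuous_const)).continuousAt.mono_left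
      nhdsWithin_le_nhds
  have h2 : Filter.Tendsto (fun c : ℝ => ((c * t) ^ (2 * k))⁻¹) (𝓝[>] 1)
      (𝓝 ((1 * t) ^ (2 * k))⁻¹) := by
    refine Filter.Tendsto.inv₀ ?_ (pow_ne_zero _ (by simpa using ht0))
    exact ((continuous_id.mul continuous_const).pow _).continuousAt.mono_left nhdsWithin_le_nhds
  rw [one_mul] at h1 h2
  refine tendsto_nhds_unique_of_eventuallyEq h1 h2 ?_
  filter_upwards [self_mem_nhdsWithin] with c hc
  refine hf.deriv_eq_of_one_lt hk ?_
  rw [Set.mem_Ioi] at hc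
  rw [abs_mul, abs_of_pos (by linarith)]
  nlinarith

/-- Outside `[-1, 1]` the derivative is the inverse of an even power. Positivity on the whole line
makes `1/f'` smooth everywhere, including on neighbourhoods of the end points `±1`. -/
theorem IsDesingularizer.deriv_pos' (hk : 1 ≤ k) (hf : IsDesingularizer k f) (t : ℝ) :
    0 < deriv f t := by
  rcases le_total |t| 1 with h | h
  · exact hf.deriv_pos t (Set.mem_Icc.2 (abs_le.1 h))
  · rw [hf.deriv_eq hk h, inv_pos, pow_mul]
    have : t ≠ 0 := by
      rintro rfl
      simp at h
      linarith
    positivity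

/-- The reciprocal of the derivative of a desingularizing function. -/
theorem IsDesingularizer.contDiff_inv_deriv (hk : 1 ≤ k) (hf : IsDesingularizer k f) :
    ContDiff ℝ ∞ fun t => (deriv f t)⁻¹ :=
  (contDiff_infty_iff_deriv.1 hf.smooth).2.inv fun t => (hf.deriv_pos' hk t).ne'

/-- The reciprocal of `f_ε'`, which desingularizes `t ^ (2 k)`. -/
noncomputable def invDeriv (k : ℕ) (f : ℝ → ℝ) (ε t : ℝ) : ℝ := ε ^ (2 * k) * (deriv f (t / ε))⁻¹

theorem invDeriv_eq_pow (hk : 1 ≤ k) (hf : IsDesingularizer k f) {ε t : ℝ} (hε : 0 < ε)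
    (ht : ε ≤ |t|) : invDeriv k f ε t = t ^ (2 * k) := by
  rw [invDeriv, hf.deriv_eq hk (by rwa [abs_div, abs_of_pos hε, one_le_div hε]), inv_inv,
    ← mul_pow, mul_div_cancel₀ _ hε.ne']

theorem invDeriv_pos (hk : 1 ≤ k) (hf : IsDesingularizer k f) {ε : ℝ} (hε : 0 < ε) (t : ℝ) :
    0 < invDeriv k f ε t :=
  mul_pos (pow_pos hε _) (inv_pos.2 (hf.deriv_pos' hk _))

theorem hasDerivAt_scale (hk : 1 ≤ k) (hf : IsDesingularizer k f) {ε : ℝ} (hε : 0 < ε) (t : ℝ) :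
    HasDerivAt (scale k f ε) (invDeriv k f ε t)⁻¹ t := by
  have h1 : HasDerivAt f (deriv f (t / ε)) (t / ε) :=
    (hf.smooth.differentiable (by simp) _).hasDerivAt
  have h2 := (h1.comp t ((hasDerivAt_id t).div_const ε)).const_mul (1 / ε ^ (2 * k - 1))
  refine h2.congr_deriv ?_
  rw [invDeriv, mul_inv, inv_inv]
  -- The prefactor contributes `ε^{-(2k-1)}` and the chain rule one more `ε⁻¹`, which gives the
  -- exponent `2k` in `invDeriv`.
  obtain ⟨n, hn⟩ : ∃ n, 2 * k = n + 1 := ⟨2 * k - 1, by omega⟩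
  rw [hn, Nat.add_sub_cancel]
  field_simp
  ring

theorem contDiff_inv_invDeriv (hf : IsDesingularizer k f) (ε : ℝ) :
    ContDiff ℝ ∞ fun t => (invDeriv k f ε t)⁻¹ := by
  simp only [invDeriv, mul_inv, inv_inv]
  exact contDiff_const.mul ((contDiff_infty_iff_deriv.1 hf.smooth).2.comp
    (contDiff_id.div_const ε))

theorem diff_scale {E : Type*} [NormedAddCommGroup E] [NormedSpace ℝ E]
    {M : Type*} [TopologicalSpace M] [ChartedSpace E M] {x : M → ℝ} {p : M}
    (hx : MDifferentiableAt 𝓘(ℝ, E) 𝓘(ℝ, ℝ) x p) (hk : 1 ≤ k) (hf : IsDesingularizer k f) {ε : ℝ}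
    (hε : 0 < ε) :
    diff (E := E) (fun q => scale k f ε (x q)) p = (invDeriv k f ε (x p))⁻¹ • diff x p := by
  have h := mfderiv_comp p (hasDerivAt_scale hk hf hε (x p)).differentiableAt.mdifferentiableAt hx
  rw [mfderiv_eq_fderiv, (hasDerivAt_scale hk hf hε (x p)).hasFDerivAt.fderiv] at h
  ext v
  change mfderiv 𝓘(ℝ, E) 𝓘(ℝ, ℝ) (scale k f ε ∘ x) p (v 0) = _
  rw [h]
  change (dAt x p (v 0) : ℝ) * (invDeriv k f ε (x p))⁻¹ = (invDeriv k f ε (x p))⁻¹ * dAt x p (v 0)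
  exact mul_comm _ _

end Desingularizer

/-! ### Derivatives of functions that depend on a rescaled variable -/

section Rescaling

variable {E : Type*} [NormedAddCommGroup E] [NormedSpace ℝ E]

/-- The Faà di Bruno bound at one point, obtained from the version on sets by restricting to open
neighbourhoods on which both maps are `C^n`. -/
theorem norm_iteratedFDeriv_comp_le_of_contDiffAt {F G : Type*} [NormedAddCommGroup F]
    [NormedSpace ℝ F] [NormedAddCommGroup G] [NormedSpace ℝ G] {g : F → G} {f : E → F} {n : ℕ} {y : E}
    (hg : ContDiffAt ℝ n g (f y)) (hf : ContDiffAt ℝ n f y) {C D : ℝ}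
    (hC : ∀ i ≤ n, ‖iteratedFDeriv ℝ i g (f y)‖ ≤ C)
    (hD : ∀ i, 1 ≤ i → i ≤ n → ‖iteratedFDeriv ℝ i f y‖ ≤ D ^ i) :
    ‖iteratedFDeriv ℝ n (fun z => g (f z)) y‖ ≤ n.factorial * C * D ^ n := by
  obtain ⟨t, ht, hto, hyt⟩ := mem_nhds_iff.1 (hg.eventually (by simp))
  obtain ⟨s, hs, hso, hys⟩ := mem_nhds_iff.1
    ((hf.eventually (by simp)).and (hf.continuousAt.eventually (hto.mem_nhds hyt)))
  have h := norm_iteratedFDerivWithin_comp_le (n := n) (N := n)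
    (fun z hz => ContDiffAt.contDiffWithinAt (show ContDiffAt ℝ n g z from ht hz))
    (fun z hz => (hs hz).1.contDiffWithinAt) le_rfl hto.uniqueDiffOn hso.uniqueDiffOn
    (fun z hz => (hs hz).2) hys (C := C) (D := D)
    (fun i hi => by rw [iteratedFDerivWithin_of_isOpen i hto hyt]; exact hC i hi)
    (fun i h1 hi => by rw [iteratedFDerivWithin_of_isOpen i hso hys]; exact hD i h1 hi)
  rwa [iteratedFDerivWithin_of_isOpen n hso hys] at h

theorem continuousAt_iteratedFDeriv {F : Type*} [NormedAddCommGroup F] [NormedSpace ℝ F] {f : E → F}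
    {y : E} (hf : ContDiffAt ℝ ∞ f y) (i : ℕ) : ContinuousAt (iteratedFDeriv ℝ i f) y :=
  (hf.iteratedFDeriv_right (m := 0) (i := i)
    (by rw [zero_add]; exact WithTop.coe_le_coe.2 le_top)).continuousAt

theorem exists_eventually_bound_iteratedFDeriv {F : Type*} [NormedAddCommGroup F] [NormedSpace ℝ F]
    {f : E → F} {y : E} (hf : ContDiffAt ℝ ∞ f y) (n : ℕ) :
    ∃ C : ℝ, 1 ≤ C ∧ ∀ᶠ z in 𝓝 y, ∀ i ≤ n, ‖iteratedFDeriv ℝ i f z‖ ≤ C := by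
  refine ⟨∑ i ∈ Finset.range (n + 1), ‖iteratedFDeriv ℝ i f y‖ + 1,
    le_add_of_nonneg_left (Finset.sum_nonneg fun _ _ => norm_nonneg _), ?_⟩
  have h : ∀ᶠ z in 𝓝 y, ∀ i ∈ Finset.range (n + 1),
      ‖iteratedFDeriv ℝ i f z‖ < ‖iteratedFDeriv ℝ i f y‖ + 1 :=
    (Filter.eventually_all_finset _).2 fun i _ =>
      (continuousAt_iteratedFDeriv hf i).norm.eventually_lt continuousAt_const (lt_add_one _)
  filter_upwards [h] with z hz i hi
  have hi' : i ∈ Finset.range (n + 1) := Finset.mem_range.2 (Nat.lt_succ_of_le hi)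
  refine (hz i hi').le.trans (add_le_add ?_ le_rfl)
  exact Finset.single_le_sum (f := fun i => ‖iteratedFDeriv ℝ i f y‖)
    (fun _ _ => norm_nonneg _) hi'

/-- A tube lemma argument: derivatives are bounded on the compact slice `{w} × K`, and by continuity
on a neighbourhood of it. Later `K = [-1, 1]` is the range of the rescaled variable `x/ε`. -/
theorem exists_eventually_bound_iteratedFDeriv_of_isCompact {F G H : Type*} [NormedAddCommGroup F]
    [NormedSpace ℝ F] [NormedAddCommGroup G] [NormedSpace ℝ G] [NormedAddCommGroup H]
    [NormedSpace ℝ H] {Φ : F × G → H} {w : F} {K : Set G} (hK : IsCompact K)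
    (hΦ : ∀ s ∈ K, ContDiffAt ℝ ∞ Φ (w, s)) (n : ℕ) :
    ∃ C : ℝ, ∀ᶠ v in 𝓝 w, ∀ s ∈ K, ∀ i ≤ n, ‖iteratedFDeriv ℝ i Φ (v, s)‖ ≤ C := by
  have h1 (i : ℕ) : ∃ C : ℝ, ∀ s ∈ K, ‖iteratedFDeriv ℝ i Φ (w, s)‖ ≤ C :=
    hK.exists_bound_of_continuousOn fun s hs =>
      ((continuousAt_iteratedFDeriv (hΦ s hs) i).comp (f := fun s => (w, s))
        (continuousAt_const.prodMk continuousAt_id)).continuousWithinAt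
  choose C hC using h1
  refine ⟨∑ i ∈ Finset.range (n + 1), |C i| + 1,
    hK.eventually_forall_of_forall_eventually fun s hs => ?_⟩
  have h : ∀ᶠ z in 𝓝 (w, s), ∀ i ∈ Finset.range (n + 1), ‖iteratedFDeriv ℝ i Φ z‖ < |C i| + 1 :=
    (Filter.eventually_all_finset _).2 fun i _ =>
      (continuousAt_iteratedFDeriv (hΦ s hs) i).norm.eventually_lt continuousAt_const
        (((hC i s hs).trans (le_abs_self _)).trans_lt (lt_add_one _))
  filter_upwards [h] with z hz i hi
  have hi' : i ∈ Finset.range (n + 1) := Finset.mem_range.2 (Nat.lt_succ_of_le hi)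
  refine (hz i hi').le.trans (add_le_add ?_ le_rfl)
  exact Finset.single_le_sum (f := fun i => |C i|) (fun _ _ => abs_nonneg _) hi'

theorem tendsto_swap_nhdsGT {E : Type*} [TopologicalSpace E] (y : E) :
    Filter.Tendsto (fun p : ℝ × E => (p.2, p.1)) (𝓝[>] (0 : ℝ) ×ˢ 𝓝 y) (𝓝 (y, (0 : ℝ))) :=
  Filter.tendsto_snd.prodMk_nhds (Filter.tendsto_fst.mono_right nhdsWithin_le_nhds)

/-- Up to a constant, the map is `z ↦ (z, x z)` followed by a linear map of norm at most `1/ε`, so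
its derivatives are at most `C/ε`. The weaker bound `(C/ε)^i`, valid since `C/ε ≥ 1`, is the shape
required by the composition estimate. -/
theorem norm_iteratedFDeriv_rescale_le {x : E → ℝ} {y : E} {n i : ℕ} {ε C : ℝ}
    (hx : ContDiffAt ℝ n x y) (hε : 0 < ε) (hε1 : ε ≤ 1) (hC1 : 1 ≤ C) (hi1 : 1 ≤ i) (hi : i ≤ n)
    (hC : ‖iteratedFDeriv ℝ i (fun z => (z, x z)) y‖ ≤ C) :
    ‖iteratedFDeriv ℝ i (fun z => ((z, ε), x z / ε)) y‖ ≤ (C / ε) ^ i := by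
  let A : E × ℝ →L[ℝ] (E × ℝ) × ℝ :=
    ((ContinuousLinearMap.fst ℝ E ℝ).prod (0 : E × ℝ →L[ℝ] ℝ)).prod
      (ε⁻¹ • ContinuousLinearMap.snd ℝ E ℝ)
  have hG : ContDiffAt ℝ n (fun z => (z, x z)) y := contDiffAt_id.prodMk hx
  have hi' : (i : ℕ∞ω) ≤ n := by exact_mod_cast hi
  have hA : ‖A‖ ≤ 1 / ε := by
    have h1 : 1 ≤ 1 / ε := (one_le_div hε).2 hε1
    refine A.opNorm_le_bound (by positivity) fun v => ?_
    have e1 : ‖v.1‖ ≤ 1 / ε * ‖v‖ :=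
      (norm_fst_le v).trans (le_mul_of_one_le_left (norm_nonneg _) h1)
    have e2 : ‖ε⁻¹ * v.2‖ ≤ 1 / ε * ‖v‖ := by
      rw [norm_mul, norm_inv, Real.norm_of_nonneg hε.le, ← one_div]
      exact mul_le_mul_of_nonneg_left (norm_snd_le v) (by positivity)
    change ‖((v.1, (0 : ℝ)), ε⁻¹ * v.2)‖ ≤ _
    simp only [Prod.norm_mk, sup_le_iff, norm_zero]
    exact ⟨⟨e1, by positivity⟩, e2⟩
  have e : (fun z => ((z, ε), x z / ε)) = (fun _ => (((0 : E), ε), (0 : ℝ))) + A ∘ fun z => (z, x z) := by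
    funext z
    change _ = (((0 : E), ε), (0 : ℝ)) + ((z, (0 : ℝ)), ε⁻¹ * x z)
    simp [div_eq_inv_mul]
  have h0 : iteratedFDeriv ℝ i (fun z => ((z, ε), x z / ε)) y =
      iteratedFDeriv ℝ i (A ∘ fun z => (z, x z)) y := by
    rw [e, iteratedFDeriv_add_apply contDiffAt_const
      ((A.contDiff.contDiffAt.comp y hG).of_le hi'),
      iteratedFDeriv_const_of_ne (by omega), Pi.zero_apply, zero_add]
  rw [h0]
  calc _ ≤ ‖A‖ * ‖iteratedFDeriv ℝ i (fun z => (z, x z)) y‖ :=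
        A.norm_iteratedFDeriv_comp_left hG hi'
    _ ≤ 1 / ε * C := by gcongr
    _ = C / ε := by ring
    _ ≤ (C / ε) ^ i := le_self_pow₀ ((one_le_div hε).2 (hε1.trans hC1)) (by omega)

/-- If `Φ(y, ε, s)` is smooth, each derivative of `y ↦ Φ(y, ε, x(y) / ε)` costs a factor `1 / ε`. -/
theorem exists_bound_iteratedFDeriv_rescale {x : E → ℝ} {y : E} (hx : ContDiffAt ℝ ∞ x y)
    {Φ : (E × ℝ) × ℝ → ℝ} (hΦ : ∀ s ∈ Set.Icc (-1 : ℝ) 1, ContDiffAt ℝ ∞ Φ ((y, 0), s)) (j : ℕ) :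
    ∃ C : ℝ, ∀ᶠ p : ℝ × E in 𝓝[>] (0 : ℝ) ×ˢ 𝓝 y, |x p.2| ≤ p.1 →
      ContDiffAt ℝ j (fun z => Φ ((z, p.1), x z / p.1)) p.2 ∧
      ‖iteratedFDeriv ℝ j (fun z => Φ ((z, p.1), x z / p.1)) p.2‖ ≤ C / p.1 ^ j := by
  obtain ⟨C₁, hC₁⟩ := exists_eventually_bound_iteratedFDeriv_of_isCompact isCompact_Icc hΦ j
  obtain ⟨C₂, h1C₂, hC₂⟩ := exists_eventually_bound_iteratedFDeriv (contDiffAt_id.prodMk hx) j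
  have hsm : ∀ᶠ v in 𝓝 (y, (0 : ℝ)), ∀ s ∈ Set.Icc (-1 : ℝ) 1, ContDiffAt ℝ j Φ (v, s) :=
    isCompact_Icc.eventually_forall_of_forall_eventually fun s hs =>
      ((hΦ s hs).of_le (WithTop.coe_le_coe.2 le_top)).eventually (by simp)
  have hxj : ∀ᶠ z in 𝓝 y, ContDiffAt ℝ j x z :=
    (hx.of_le (WithTop.coe_le_coe.2 le_top)).eventually (by simp)
  refine ⟨j.factorial * C₁ * C₂ ^ j, ?_⟩
  have hpos : ∀ᶠ p : ℝ × E in 𝓝[>] (0 : ℝ) ×ˢ 𝓝 y, p.1 ∈ Set.Ioc (0 : ℝ) 1 :=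
    Filter.tendsto_fst.eventually (Ioc_mem_nhdsGT one_pos)
  filter_upwards [(tendsto_swap_nhdsGT y).eventually hC₁, (tendsto_swap_nhdsGT y).eventually hsm,
    Filter.tendsto_snd.eventually hC₂, Filter.tendsto_snd.eventually hxj, hpos]
    with p h1 h2 h3 h4 h5 hp
  have hs : x p.2 / p.1 ∈ Set.Icc (-1 : ℝ) 1 := by
    rw [Set.mem_Icc, ← abs_le, abs_div, abs_of_pos h5.1]
    exact (div_le_one h5.1).2 hp
  have hin : ContDiffAt ℝ j (fun z => ((z, p.1), x z / p.1)) p.2 :=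
    (contDiffAt_id.prodMk contDiffAt_const).prodMk (h4.div_const _)
  refine ⟨ContDiffAt.comp (g := Φ) (f := fun z => ((z, p.1), x z / p.1)) p.2 (h2 _ hs) hin, ?_⟩
  have hD (i : ℕ) (hi1 : 1 ≤ i) (hi : i ≤ j) :=
    norm_iteratedFDeriv_rescale_le h4 h5.1 h5.2 h1C₂ hi1 hi (h3 i hi)
  refine (norm_iteratedFDeriv_comp_le_of_contDiffAt (g := Φ)
    (f := fun z => ((z, p.1), x z / p.1)) (h2 _ hs) hin (h1 _ hs) hD).trans_eq ?_
  rw [div_pow]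
  ring

/-- Convergence of derivatives for perturbations of the form `ε ^ m Φ(y, ε, x(y) / ε)` supported in
`|x| ≤ ε`. -/
theorem eventually_norm_iteratedFDeriv_sub_lt {x : E → ℝ} {y : E} (hx : ContDiffAt ℝ ∞ x y)
    {Φ : (E × ℝ) × ℝ → ℝ} (hΦ : ∀ s ∈ Set.Icc (-1 : ℝ) 1, ContDiffAt ℝ ∞ Φ ((y, 0), s)) {j m : ℕ}
    (hj : j < m) {c : ℝ → E → ℝ} {c₀ : E → ℝ} (hc₀ : ContDiffAt ℝ ∞ c₀ y)
    (hc : ∀ᶠ p : ℝ × E in 𝓝[>] (0 : ℝ) ×ˢ 𝓝 y, |x p.2| ≤ p.1 →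
      c p.1 =ᶠ[𝓝 p.2] fun z => c₀ z + p.1 ^ m * Φ ((z, p.1), x z / p.1))
    (hc' : ∀ᶠ p : ℝ × E in 𝓝[>] (0 : ℝ) ×ˢ 𝓝 y, p.1 < |x p.2| → c p.1 =ᶠ[𝓝 p.2] c₀)
    {δ : ℝ} (hδ : 0 < δ) :
    ∀ᶠ p : ℝ × E in 𝓝[>] (0 : ℝ) ×ˢ 𝓝 y,
      dist (iteratedFDeriv ℝ j c₀ p.2) (iteratedFDeriv ℝ j (c p.1) p.2) < δ := by
  obtain ⟨C, hC⟩ := exists_bound_iteratedFDeriv_rescale hx hΦ j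
  have hlim : Filter.Tendsto (fun ε : ℝ => C * ε ^ (m - j)) (𝓝[>] 0) (𝓝 0) := by
    have h : Filter.Tendsto (fun ε : ℝ => C * ε ^ (m - j)) (𝓝 0) (𝓝 (C * 0 ^ (m - j))) :=
      (continuous_const.mul (continuous_pow _)).tendsto 0
    rw [zero_pow (by omega), mul_zero] at h
    exact h.mono_left nhdsWithin_le_nhds
  have hc₀j : ∀ᶠ z in 𝓝 y, ContDiffAt ℝ j c₀ z :=
    (hc₀.of_le (WithTop.coe_le_coe.2 le_top)).eventually (by simp)
  filter_upwards [hC, hc, hc', Filter.tendsto_fst.eventually (hlim.eventually_lt_const hδ),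
    Filter.tendsto_fst.eventually (self_mem_nhdsWithin : Set.Ioi (0 : ℝ) ∈ 𝓝[>] 0),
    Filter.tendsto_snd.eventually hc₀j] with p h1 h2 h3 h4 h5 h6
  rcases le_or_gt |x p.2| p.1 with h | h
  · obtain ⟨h1s, h1b⟩ := h1 h
    have e := (h2 h).iteratedFDeriv ℝ j |>.eq_of_nhds
    have hs : ContDiffAt ℝ j (fun z => p.1 ^ m • Φ ((z, p.1), x z / p.1)) p.2 :=
      h1s.const_smul (p.1 ^ m)
    have e' : iteratedFDeriv ℝ j (fun z => c₀ z + p.1 ^ m * Φ ((z, p.1), x z / p.1)) p.2 =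
        iteratedFDeriv ℝ j c₀ p.2 +
          p.1 ^ m • iteratedFDeriv ℝ j (fun z => Φ ((z, p.1), x z / p.1)) p.2 := by
      rw [← iteratedFDeriv_const_smul_apply' h1s]
      exact iteratedFDeriv_add_apply h6 hs
    rw [e, e', dist_self_add_right, norm_smul, norm_pow, Real.norm_of_nonneg (le_of_lt h5)]
    refine lt_of_le_of_lt ?_ h4
    -- The factor `ε^m` outweighs the loss `ε^{-j}` because `j < m`.
    calc p.1 ^ m * _ ≤ p.1 ^ m * (C / p.1 ^ j) :=
          mul_le_mul_of_nonneg_left h1b (pow_nonneg (le_of_lt h5) _)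
      _ = C * p.1 ^ (m - j) := by
          rw [← pow_sub_mul_pow p.1 hj.le]
          have : p.1 ≠ 0 := ne_of_gt h5
          field_simp
  · rw [((h3 h).iteratedFDeriv ℝ j).eq_of_nhds, dist_self]
    exact hδ

end Rescaling

/-! ### Dual bivectors that depend on a parameter -/

section Family

variable {E : Type*} [NormedAddCommGroup E] [NormedSpace ℝ E] [FiniteDimensional ℝ E]
  {M : Type*} [TopologicalSpace M] [ChartedSpace E M]
  {x : M → ℝ} {α : DForm E M 1} {β : DForm E M 2} {e : OpenPartialHomeomorph M E}

/-- The difference quotient of `chartDual` in its last variable, up to sign. -/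
noncomputable def chartDualSlope (x : M → ℝ) (α : DForm E M 1) (β : DForm E M 2)
    (e : OpenPartialHomeomorph M E) (ξ η : Module.Dual ℝ E) (y : E) (μ ν : ℝ) : ℝ :=
  - η ((chartBorder x α β e y μ).inverse (borderSlope E
    ((chartBorder x α β e y ν).inverse (LinearMap.toContinuousLinearMap ξ, 0, 0)))).1

/-- The resolvent identity `T_μ⁻¹ - T_ν⁻¹ = (ν - μ) T_μ⁻¹ S T_ν⁻¹`, where `T_μ - T_ν = (μ - ν) S`
since the bordered system is affine in its parameter. -/
theorem chartDual_eq_add {y : E} {μ ν : ℝ} (hμ : (chartBorder x α β e y μ).IsInvertible)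
    (hν : (chartBorder x α β e y ν).IsInvertible) (ξ η : Module.Dual ℝ E) :
    chartDual x α β e ξ η y μ =
      chartDual x α β e ξ η y ν + (ν - μ) * chartDualSlope x α β e ξ η y μ ν := by
  set r : (E →L[ℝ] ℝ) × ℝ × ℝ := (LinearMap.toContinuousLinearMap ξ, 0, 0) with hr
  set u := (chartBorder x α β e y μ).inverse r with hu
  set v := (chartBorder x α β e y ν).inverse r with hv
  have hTu : chartBorder x α β e y μ u = r := hμ.self_apply_inverse r
  have hTv : chartBorder x α β e y ν v = r := hν.self_apply_inverse r
  have hsub : chartBorder x α β e y μ v - chartBorder x α β e y ν v = (μ - ν) • borderSlope E v :=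
    DFunLike.congr_fun (border_sub_border (fderiv ℝ (fun z => x (e.symm z)) y) (α.inChart e y)
      (β.inChart e y) μ ν) v
  have huv : u = v + (ν - μ) • (chartBorder x α β e y μ).inverse (borderSlope E v) := by
    refine hμ.injective ?_
    rw [map_add, map_smul, hμ.self_apply_inverse (borderSlope E v), hTu, ← hTv,
      eq_add_of_sub_eq hsub, ← neg_sub μ ν]
    module
  rw [chartDual, chartDual, chartDualSlope, ← hr, ← hu, ← hv, huv, Prod.fst_add, Prod.smul_fst,
    map_add, map_smul, smul_eq_mul]
  ring

variable [IsManifold 𝓘(ℝ, E) ∞ M]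

theorem contDiffAt_chartBorder (hx : ContMDiff 𝓘(ℝ, E) 𝓘(ℝ, ℝ) ∞ x) (he : e ∈ atlas E M)
    {D : Type*} [NormedAddCommGroup D] [NormedSpace ℝ D] {Y : D → E} {μ : D → ℝ} {w : D}
    (hY : ContDiffAt ℝ ∞ Y w) (hμ : ContDiffAt ℝ ∞ μ w) (hy : Y w ∈ e.target)
    (hα : ContDiffAt ℝ ∞ (α.inChart e) (Y w)) (hβ : ContDiffAt ℝ ∞ (β.inChart e) (Y w)) :
    ContDiffAt ℝ ∞ (fun z => chartBorder x α β e (Y z) (μ z)) w :=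
  ContDiffAt.border (((contDiffAt_fderiv_comp_chart_symm hx he hy)).comp w hY) (hα.comp w hY)
    (hβ.comp w hY) hμ

theorem contDiffAt_inverse_chartBorder (hx : ContMDiff 𝓘(ℝ, E) 𝓘(ℝ, ℝ) ∞ x) (he : e ∈ atlas E M)
    {D : Type*} [NormedAddCommGroup D] [NormedSpace ℝ D] {Y : D → E} {μ : D → ℝ} {w : D}
    (hY : ContDiffAt ℝ ∞ Y w) (hμ : ContDiffAt ℝ ∞ μ w) (hy : Y w ∈ e.target)
    (hα : ContDiffAt ℝ ∞ (α.inChart e) (Y w)) (hβ : ContDiffAt ℝ ∞ (β.inChart e) (Y w))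
    (hinv : (chartBorder x α β e (Y w) (μ w)).IsInvertible) :
    ContDiffAt ℝ ∞ (fun z => (chartBorder x α β e (Y z) (μ z)).inverse) w := by
  have h : ContDiffAt ℝ ∞ ContinuousLinearMap.inverse (chartBorder x α β e (Y w) (μ w)) :=
    hinv.contDiffAt_map_inverse
  exact h.comp w (contDiffAt_chartBorder hx he hY hμ hy hα hβ)

theorem contDiffAt_neg_dual_fst (η : Module.Dual ℝ E) {D : Type*} [NormedAddCommGroup D]
    [NormedSpace ℝ D] {v : D → E × ℝ × ℝ} {w : D} (hv : ContDiffAt ℝ ∞ v w) :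
    ContDiffAt ℝ ∞ (fun z => - η (v z).1) w :=
  ((LinearMap.toContinuousLinearMap η).contDiff.contDiffAt.comp w
    (contDiff_fst.contDiffAt.comp w hv)).neg

theorem contDiffAt_chartDual (hx : ContMDiff 𝓘(ℝ, E) 𝓘(ℝ, ℝ) ∞ x) (he : e ∈ atlas E M)
    {μ : E → ℝ} {y : E} (hμ : ContDiffAt ℝ ∞ μ y) (hy : y ∈ e.target)
    (hα : ContDiffAt ℝ ∞ (α.inChart e) y) (hβ : ContDiffAt ℝ ∞ (β.inChart e) y)
    (hinv : (chartBorder x α β e y (μ y)).IsInvertible) (ξ η : Module.Dual ℝ E) :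
    ContDiffAt ℝ ∞ (fun z => chartDual x α β e ξ η z (μ z)) y :=
  contDiffAt_neg_dual_fst η <| ContDiffAt.clm_apply
    (contDiffAt_inverse_chartBorder hx he (Y := id) contDiffAt_id hμ hy hα hβ hinv)
    contDiffAt_const

theorem contDiffAt_chartDualSlope (hx : ContMDiff 𝓘(ℝ, E) 𝓘(ℝ, ℝ) ∞ x) (he : e ∈ atlas E M)
    {D : Type*} [NormedAddCommGroup D] [NormedSpace ℝ D] {Y : D → E} {μ ν : D → ℝ} {w : D}
    (hY : ContDiffAt ℝ ∞ Y w) (hμ : ContDiffAt ℝ ∞ μ w) (hν : ContDiffAt ℝ ∞ ν w)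
    (hy : Y w ∈ e.target)
    (hα : ContDiffAt ℝ ∞ (α.inChart e) (Y w)) (hβ : ContDiffAt ℝ ∞ (β.inChart e) (Y w))
    (hinv : (chartBorder x α β e (Y w) (μ w)).IsInvertible)
    (hinv' : (chartBorder x α β e (Y w) (ν w)).IsInvertible) (ξ η : Module.Dual ℝ E) :
    ContDiffAt ℝ ∞ (fun z => chartDualSlope x α β e ξ η (Y z) (μ z) (ν z)) w :=
  contDiffAt_neg_dual_fst η <|
    (contDiffAt_inverse_chartBorder hx he hY hμ hy hα hβ hinv).clm_apply <|
      (borderSlope E).contDiff.contDiffAt.comp w <|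
        (contDiffAt_inverse_chartBorder hx he hY hν hy hα hβ hinv').clm_apply contDiffAt_const

theorem eventually_isInvertible {D X Y : Type*} [TopologicalSpace D] [NormedAddCommGroup X]
    [NormedSpace ℝ X] [CompleteSpace X] [NormedAddCommGroup Y] [NormedSpace ℝ Y] {T : D → X →L[ℝ] Y}
    {w : D} (hT : ContinuousAt T w) (h : (T w).IsInvertible) : ∀ᶠ z in 𝓝 w, (T z).IsInvertible :=
  hT.eventually ((ContinuousLinearEquiv.isOpen (𝕜 := ℝ) (E := X) (F := Y)).mem_nhds h)

end Family

/-! ### Off the hypersurface -/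

section OffHypersurface

variable {E : Type*} [NormedAddCommGroup E] [NormedSpace ℝ E]
  {M : Type*} [TopologicalSpace M] [ChartedSpace E M] {x : M → ℝ} {m : ℕ} {Ω : BForm E x m}

theorem toForm_eq_conormalForm {α : DForm E M 1} {β : DForm E M 2} {p : M} (hp : x p ≠ 0)
    (hΩ : Ω p = BForm.ofForms x m α β p) :
    Ω.toForm p = conormalForm x (fun q => (x q ^ m)⁻¹) α β p := by
  rw [BForm.toForm, dif_pos hp, hΩ]
  have e (c : Tan E p [⋀^Fin 1]→L[ℝ] ℝ) (u : Tan E p) :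
      (c.compContinuousLinearMap (anchor x m p)) ![lift x m p hp u] = c ![u] := by
    change c (fun i => anchor x m p (![lift x m p hp u] i)) = _
    congr 1
    ext i; fin_cases i; rfl
  ext v
  change (x p ^ m)⁻¹ * dAt x p (v 0) *
      (α p).compContinuousLinearMap (anchor x m p) ![lift x m p hp (v 1)] -
    (x p ^ m)⁻¹ * dAt x p (v 1) *
      (α p).compContinuousLinearMap (anchor x m p) ![lift x m p hp (v 0)] + β p v = _
  rw [e, e]
  rfl

variable [IsManifold 𝓘(ℝ, E) ∞ M] [FiniteDimensional ℝ E] {e : OpenPartialHomeomorph M E} {y : E}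

theorem contDiffAt_toForm_inChart (hx : ContMDiff 𝓘(ℝ, E) 𝓘(ℝ, ℝ) ∞ x) (hΩ : Ω.IsBSymplectic)
    (he : e ∈ atlas E M) (hy : y ∈ e.target) (hxy : x (e.symm y) ≠ 0) :
    ContDiffAt ℝ ∞ (Ω.toForm.inChart e) y := by
  obtain ⟨V, hV, hyV, α, β, hα, hβ, h⟩ := hΩ.smooth (e.symm y)
  have hxe := contDiffAt_comp_chart_symm he hy hx.contMDiffAt
  have hsm : ContDiffAt ℝ ∞ ((conormalForm x (fun q => (x q ^ m)⁻¹) α β).inChart e) y :=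
    contDiffAt_conormalForm_inChart hx he hy ((hxe.pow m).inv (pow_ne_zero _ hxy))
      (hα.contDiffAt hV he hy hyV) (hβ.contDiffAt hV he hy hyV)
  refine hsm.congr_of_eventuallyEq ?_
  filter_upwards [eventually_chart hV hy hyV, hxe.continuousAt.eventually_ne hxy] with z hz hz'
  exact DForm.inChart_congr (toForm_eq_conormalForm hz' (h _ hz.2))

theorem contDiffAt_coeff_poisson (hx : ContMDiff 𝓘(ℝ, E) 𝓘(ℝ, ℝ) ∞ x)
    (hreg : ∀ p : M, x p = 0 → mfderiv 𝓘(ℝ, E) 𝓘(ℝ, ℝ) x p ≠ 0) (hΩ : Ω.IsBSymplectic)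
    (he : e ∈ atlas E M) (hy : y ∈ e.target) (ξ η : Module.Dual ℝ E) :
    ContDiffAt ℝ ∞ (Ω.poisson.coeff e ξ η) y := by
  obtain ⟨V, hV, hyV, α, β, hα, hβ, h⟩ := hΩ.smooth (e.symm y)
  have hxe := contDiffAt_comp_chart_symm he hy hx.contMDiffAt
  refine (contDiffAt_chartDual hx he (hxe.pow m) hy (hα.contDiffAt hV he hy hyV)
    (hβ.contDiffAt hV he hy hyV) (isInvertible_chartBorder_of_bform hx hreg he hy (h _ hyV)
      (hΩ.nondegenerate _)) ξ η).congr_of_eventuallyEq ?_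
  filter_upwards [eventually_chart hV hy hyV] with z hz
  exact coeff_poisson hx hreg he hz.1 (h _ hz.2) (hΩ.nondegenerate _) ξ η

theorem isInvertible_chartBorder_inv_inv (hx : ContMDiff 𝓘(ℝ, E) 𝓘(ℝ, ℝ) ∞ x)
    (hreg : ∀ p : M, x p = 0 → mfderiv 𝓘(ℝ, E) 𝓘(ℝ, ℝ) x p ≠ 0) (hΩ : Ω.IsBSymplectic)
    (he : e ∈ atlas E M) (hy : y ∈ e.target) {α : DForm E M 1} {β : DForm E M 2}
    (h : Ω (e.symm y) = BForm.ofForms x m α β (e.symm y)) :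
    (chartBorder x α β e y ((x (e.symm y) ^ m)⁻¹)⁻¹).IsInvertible := by
  rw [inv_inv]
  exact isInvertible_chartBorder_of_bform hx hreg he hy h (hΩ.nondegenerate _)

theorem nondegenerate_toForm (hx : ContMDiff 𝓘(ℝ, E) 𝓘(ℝ, ℝ) ∞ x)
    (hreg : ∀ p : M, x p = 0 → mfderiv 𝓘(ℝ, E) 𝓘(ℝ, ℝ) x p ≠ 0) (hΩ : Ω.IsBSymplectic) {p : M}
    (hp : x p ≠ 0) : Nondegenerate (Ω.toForm p) := by
  obtain ⟨e, he, y, hy, rfl⟩ : ∃ e ∈ atlas E M, ∃ y ∈ e.target, e.symm y = p :=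
    ⟨chartAt E p, chart_mem_atlas E p, chartAt E p p, mem_chart_target E p,
      (chartAt E p).left_inv (mem_chart_source E p)⟩
  obtain ⟨V, -, hyV, α, β, -, -, h⟩ := hΩ.smooth (e.symm y)
  rw [toForm_eq_conormalForm hp (h _ hyV)]
  exact nondegenerate_conormalForm hx he hy (inv_ne_zero (pow_ne_zero m hp))
    (isInvertible_chartBorder_inv_inv hx hreg hΩ he hy (h _ hyV))

theorem coeff_dualBivector_eq_poisson (hx : ContMDiff 𝓘(ℝ, E) 𝓘(ℝ, ℝ) ∞ x)
    (hreg : ∀ p : M, x p = 0 → mfderiv 𝓘(ℝ, E) 𝓘(ℝ, ℝ) x p ≠ 0) (hΩ : Ω.IsBSymplectic)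
    (he : e ∈ atlas E M) (hy : y ∈ e.target) (hxy : x (e.symm y) ≠ 0) {Ω' : DForm E M 2}
    (hΩ' : Ω' (e.symm y) = Ω.toForm (e.symm y)) (ξ η : Module.Dual ℝ E) :
    BivectorField.coeff (fun p => dualBivector (Ω' p)) e ξ η y = Ω.poisson.coeff e ξ η y := by
  obtain ⟨V, -, hyV, α, β, -, -, h⟩ := hΩ.smooth (e.symm y)
  rw [coeff_poisson hx hreg he hy (h _ hyV) (hΩ.nondegenerate _),
    coeff_dualBivector hx he hy (g := fun q => (x q ^ m)⁻¹) (inv_ne_zero (pow_ne_zero m hxy))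
      (hΩ'.trans (toForm_eq_conormalForm hxy (h _ hyV)))
      (isInvertible_chartBorder_inv_inv hx hreg hΩ he hy (h _ hyV)), inv_inv]

end OffHypersurface

/-! ### The desingularized forms -/

section Desingularization

variable {E : Type*} [NormedAddCommGroup E] [NormedSpace ℝ E]
  {F : Type*} [NormedAddCommGroup F] [NormedSpace ℝ F]
  {M : Type*} [TopologicalSpace M] [ChartedSpace E M]
  {N : Type*} [TopologicalSpace N] [ChartedSpace F N]
  {x : M → ℝ} {k : ℕ} {Ω : BForm E x (2 * k)} {ι : N → M} {U : Set M} {π : M → N}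
  {a : Fin (2 * k) → DForm F N 1} {β : DForm E M 2} {f : ℝ → ℝ}

theorem desingularization_eq_conormalForm (hx : ContMDiff 𝓘(ℝ, E) 𝓘(ℝ, ℝ) ∞ x) (hk : 1 ≤ k)
    (hf : IsDesingularizer k f) {ε : ℝ} (hε : 0 < ε) {p : M} (hp : p ∈ U) :
    desingularization Ω U π a β f ε p =
      conormalForm x (fun q => (invDeriv k f ε (x q))⁻¹) (laurentSum x π a) β p := by
  rw [desingularization, if_pos hp, diff_scale (hx.mdifferentiableAt (by simp)) hk hf hε]
  rfl

/-- At points of `U` with `|x| ≥ ε` the parameter `1/f_ε'(x)` is exactly `x^{2k}`; off `U` the forms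
agree by definition. -/
theorem desingularization_eq_toForm (hx : ContMDiff 𝓘(ℝ, E) 𝓘(ℝ, ℝ) ∞ x) (hk : 1 ≤ k)
    (hf : IsDesingularizer k f) (hL : IsLaurentSeries Ω ι U π a β) {ε : ℝ} (hε : 0 < ε) {p : M}
    (hp : ¬ (p ∈ U ∧ |x p| < ε)) : desingularization Ω U π a β f ε p = Ω.toForm p := by
  by_cases hU : p ∈ U
  · have hpε : ε ≤ |x p| := not_lt.1 fun h => hp ⟨hU, h⟩
    have hp0 : x p ≠ 0 := abs_pos.1 (hε.trans_le hpε)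
    rw [desingularization_eq_conormalForm hx hk hf hε hU,
      toForm_eq_conormalForm hp0 (hL.eq p hU)]
    simp only [conormalForm, invDeriv_eq_pow hk hf hε hpε]
  · rw [desingularization, if_neg hU]

variable {e : OpenPartialHomeomorph M E} {y : E}

theorem IsLaurentSeries.contDiffAt_beta (hL : IsLaurentSeries Ω ι U π a β) (he : e ∈ atlas E M)
    (hy : y ∈ e.target) (hyU : e.symm y ∈ U) : ContDiffAt ℝ ∞ (β.inChart e) y :=
  hL.smooth_beta.contDiffAt hL.isOpen he hy hyU

theorem desingularization_inChart_eventuallyEq_conormalForm (hx : ContMDiff 𝓘(ℝ, E) 𝓘(ℝ, ℝ) ∞ x)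
    (hk : 1 ≤ k) (hf : IsDesingularizer k f) (hU : IsOpen U)
    (hy : y ∈ e.target) (hyU : e.symm y ∈ U) {ε : ℝ} (hε : 0 < ε) :
    (desingularization Ω U π a β f ε).inChart e =ᶠ[𝓝 y]
      (conormalForm x (fun q => (invDeriv k f ε (x q))⁻¹) (laurentSum x π a) β).inChart e :=
  (eventually_chart hU hy hyU).mono fun _ hz => DForm.inChart_congr
    (desingularization_eq_conormalForm hx hk hf hε hz.2)

variable [IsManifold 𝓘(ℝ, E) ∞ M]

theorem eventually_lt_abs (hx : ContMDiff 𝓘(ℝ, E) 𝓘(ℝ, ℝ) ∞ x) (he : e ∈ atlas E M)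
    (hy : y ∈ e.target) {ε : ℝ} (h : ε < |x (e.symm y)|) :
    ∀ᶠ z in 𝓝 y, z ∈ e.target ∧ ε < |x (e.symm z)| :=
  (e.open_target.eventually_mem hy).and <|
    continuousAt_const.eventually_lt
      (contDiffAt_comp_chart_symm he hy hx.contMDiffAt).continuousAt.abs h

theorem desingularization_inChart_eventuallyEq_toForm (hx : ContMDiff 𝓘(ℝ, E) 𝓘(ℝ, ℝ) ∞ x)
    (hk : 1 ≤ k) (hf : IsDesingularizer k f) (hL : IsLaurentSeries Ω ι U π a β) (he : e ∈ atlas E M)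
    (hy : y ∈ e.target) {ε : ℝ} (hε : 0 < ε) (h : ε < |x (e.symm y)|) :
    (desingularization Ω U π a β f ε).inChart e =ᶠ[𝓝 y] Ω.toForm.inChart e :=
  (eventually_lt_abs hx he hy h).mono fun _ hz => DForm.inChart_congr
    (desingularization_eq_toForm hx hk hf hL hε fun h' => (hz.2.trans h'.2).false)

theorem extDeriv_desingularization_of_lt_abs (hx : ContMDiff 𝓘(ℝ, E) 𝓘(ℝ, ℝ) ∞ x)
    (hk : 1 ≤ k) (hf : IsDesingularizer k f) (hΩ : Ω.IsBSymplectic)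
    (hL : IsLaurentSeries Ω ι U π a β) (he : e ∈ atlas E M)
    (hy : y ∈ e.target) {ε : ℝ} (hε : 0 < ε) (h : ε < |x (e.symm y)|) :
    extDeriv ((desingularization Ω U π a β f ε).inChart e) y = 0 := by
  rw [(desingularization_inChart_eventuallyEq_toForm hx hk hf hL he hy hε h).extDeriv_eq]
  exact hΩ.closed e he y ⟨hy, abs_pos.1 (hε.trans h)⟩

variable [FiniteDimensional ℝ E]

theorem isInvertible_chartBorder_desingularization (hx : ContMDiff 𝓘(ℝ, E) 𝓘(ℝ, ℝ) ∞ x)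
    (hk : 1 ≤ k) (hf : IsDesingularizer k f) (he : e ∈ atlas E M) (hy : y ∈ e.target)
    (hyU : e.symm y ∈ U) {ε : ℝ} (hε : 0 < ε)
    (hnd : Nondegenerate (desingularization Ω U π a β f ε (e.symm y))) :
    (chartBorder x (laurentSum x π a) β e y (invDeriv k f ε (x (e.symm y)))).IsInvertible := by
  rw [desingularization_eq_conormalForm hx hk hf hε hyU] at hnd
  have h := isInvertible_chartBorder_of_conormalForm hx he hy
    (inv_ne_zero (invDeriv_pos hk hf hε _).ne') hnd
  rwa [inv_inv] at h

theorem coeff_dualBivector_desingularization (hx : ContMDiff 𝓘(ℝ, E) 𝓘(ℝ, ℝ) ∞ x)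
    (hk : 1 ≤ k) (hf : IsDesingularizer k f) (he : e ∈ atlas E M) (hy : y ∈ e.target)
    (hyU : e.symm y ∈ U) {ε : ℝ} (hε : 0 < ε)
    (hnd : Nondegenerate (desingularization Ω U π a β f ε (e.symm y))) (ξ η : Module.Dual ℝ E) :
    BivectorField.coeff (fun p => dualBivector (desingularization Ω U π a β f ε p)) e ξ η y =
      chartDual x (laurentSum x π a) β e ξ η y (invDeriv k f ε (x (e.symm y))) := by
  have h := isInvertible_chartBorder_desingularization hx hk hf he hy hyU hε hnd
  rw [← inv_inv (invDeriv k f ε (x (e.symm y)))] at h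
  rw [coeff_dualBivector hx he hy (inv_ne_zero (invDeriv_pos hk hf hε _).ne')
    (desingularization_eq_conormalForm hx hk hf hε hyU) h, inv_inv]

theorem coeff_desingularization_eventuallyEq_poisson (hx : ContMDiff 𝓘(ℝ, E) 𝓘(ℝ, ℝ) ∞ x)
    (hreg : ∀ p : M, x p = 0 → mfderiv 𝓘(ℝ, E) 𝓘(ℝ, ℝ) x p ≠ 0)
    (hk : 1 ≤ k) (hf : IsDesingularizer k f) (hΩ : Ω.IsBSymplectic)
    (hL : IsLaurentSeries Ω ι U π a β) (he : e ∈ atlas E M) (hy : y ∈ e.target) {ε : ℝ}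
    (hε : 0 < ε) (h : ε < |x (e.symm y)|) (ξ η : Module.Dual ℝ E) :
    BivectorField.coeff (fun p => dualBivector (desingularization Ω U π a β f ε p)) e ξ η =ᶠ[𝓝 y]
      Ω.poisson.coeff e ξ η :=
  (eventually_lt_abs hx he hy h).mono fun _ hz =>
    coeff_dualBivector_eq_poisson hx hreg hΩ he hz.1 (abs_pos.1 (hε.trans hz.2))
      (desingularization_eq_toForm hx hk hf hL hε fun h' => (hz.2.trans h'.2).false) ξ η

variable [FiniteDimensional ℝ F] [IsManifold 𝓘(ℝ, F) ∞ N]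

theorem IsLaurentSeries.contDiffAt_laurentSum (hx : ContMDiff 𝓘(ℝ, E) 𝓘(ℝ, ℝ) ∞ x)
    (hL : IsLaurentSeries Ω ι U π a β) (he : e ∈ atlas E M) (hy : y ∈ e.target)
    (hyU : e.symm y ∈ U) : ContDiffAt ℝ ∞ ((laurentSum x π a).inChart e) y :=
  contDiffAt_laurentSum_inChart hx hL.isOpen hL.smooth_proj he hy hyU hL.smooth_a

theorem extDeriv_desingularization (hx : ContMDiff 𝓘(ℝ, E) 𝓘(ℝ, ℝ) ∞ x)
    (hk : 1 ≤ k) (hf : IsDesingularizer k f) (hL : IsLaurentSeries Ω ι U π a β) (he : e ∈ atlas E M)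
    (hy : y ∈ e.target) (hyU : e.symm y ∈ U) {ε : ℝ} (hε : 0 < ε) :
    extDeriv ((desingularization Ω U π a β f ε).inChart e) y = extDeriv (β.inChart e) y := by
  rw [(desingularization_inChart_eventuallyEq_conormalForm hx hk hf hL.isOpen hy hyU hε).extDeriv_eq]
  exact extDeriv_conormalForm_laurentSum hx hL.isOpen hL.smooth_proj he hy hyU hL.smooth_a
    hL.closed_a (contDiff_inv_invDeriv hf ε) (hL.contDiffAt_beta he hy hyU)

/-- The regular part of a Laurent series of a closed form is closed. -/
theorem extDeriv_beta (hx : ContMDiff 𝓘(ℝ, E) 𝓘(ℝ, ℝ) ∞ x)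
    (hreg : ∀ p : M, x p = 0 → mfderiv 𝓘(ℝ, E) 𝓘(ℝ, ℝ) x p ≠ 0)
    (hk : 1 ≤ k) (hf : IsDesingularizer k f) (hΩ : Ω.IsBSymplectic)
    (hL : IsLaurentSeries Ω ι U π a β) (he : e ∈ atlas E M)
    (hy : y ∈ e.target) (hyU : e.symm y ∈ U) : extDeriv (β.inChart e) y = 0 := by
  have hoff {z : E} (hz : z ∈ e.target) (hzU : e.symm z ∈ U) (h : x (e.symm z) ≠ 0) :
      extDeriv (β.inChart e) z = 0 := by
    -- With `ε = |x|/2` the point lies outside the `ε`-collar, so there `ω_ε = ω` is closed, while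
    -- `dω_ε = dβ` on `U`.
    rw [← extDeriv_desingularization hx hk hf hL he hz hzU (half_pos (abs_pos.2 h))]
    exact extDeriv_desingularization_of_lt_abs hx hk hf hΩ hL he hz (half_pos (abs_pos.2 h))
      (half_lt_self (abs_pos.2 h))
  by_contra hne
  -- If `dβ` were nonzero at the point, it would be nonzero nearby, which forces `x = 0` on a
  -- neighbourhood and contradicts regularity.
  have h1 : ∀ᶠ z in 𝓝 y, x (e.symm z) = 0 := by
    filter_upwards [(hL.contDiffAt_beta he hy hyU).extDeriv.continuousAt.eventually_ne hne,
      eventually_chart hL.isOpen hy hyU] with z hz hz'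
    by_contra h
    exact hz (hoff hz'.1 hz'.2 h)
  have h2 : fderiv ℝ (fun z => x (e.symm z)) y = 0 := by
    rw [(show (fun z => x (e.symm z)) =ᶠ[𝓝 y] fun _ => (0 : ℝ) from h1).fderiv_eq]
    simp
  rw [← dAt_comp_chart_symm he hy (hx.mdifferentiableAt (by simp))] at h2
  refine hreg _ h1.self_of_nhds (ContinuousLinearMap.ext fun v => ?_)
  obtain ⟨w, rfl⟩ := (chartFrame_bijective he hy).2 v
  exact DFunLike.congr_fun h2 w

/-- Near a point of the hypersurface, the bordered systems of the desingularized forms are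
invertible. -/
theorem eventually_isInvertible_chartBorder (hx : ContMDiff 𝓘(ℝ, E) 𝓘(ℝ, ℝ) ∞ x)
    (hreg : ∀ p : M, x p = 0 → mfderiv 𝓘(ℝ, E) 𝓘(ℝ, ℝ) x p ≠ 0)
    (hk : 1 ≤ k) (hf : IsDesingularizer k f) (hΩ : Ω.IsBSymplectic)
    (hL : IsLaurentSeries Ω ι U π a β) (he : e ∈ atlas E M)
    (hy : y ∈ e.target) (hxy : x (e.symm y) = 0) :
    ∀ᶠ w in 𝓝 (y, (0 : ℝ)), ∀ s ∈ Set.Icc (-1 : ℝ) 1,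
      (chartBorder x (laurentSum x π a) β e w.1 (w.2 ^ (2 * k) * (deriv f s)⁻¹)).IsInvertible := by
  have hyU : e.symm y ∈ U := hL.subset hxy
  refine isCompact_Icc.eventually_forall_of_forall_eventually fun s _ => ?_
  have hc : ContDiffAt ℝ ∞ (fun q : (E × ℝ) × ℝ => chartBorder x (laurentSum x π a) β e q.1.1
      (q.1.2 ^ (2 * k) * (deriv f q.2)⁻¹)) ((y, 0), s) :=
    contDiffAt_chartBorder hx he (contDiff_fst.fst.contDiffAt)
      ((contDiff_fst.snd.pow _).mul ((hf.contDiff_inv_deriv hk).comp contDiff_snd)).contDiffAt hy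
      (hL.contDiffAt_laurentSum hx he hy hyU) (hL.contDiffAt_beta he hy hyU)
  refine eventually_isInvertible hc.continuousAt ?_
  -- At `ε = 0` the parameter is `0` for every `s`, which is also the value of `x^{2k}` on `Z`; so
  -- the limit system is that of the `b`-form itself.
  have h := isInvertible_chartBorder_of_bform hx hreg he hy (hL.eq _ hyU) (hΩ.nondegenerate _)
  rw [hxy, zero_pow (by omega)] at h
  change (chartBorder x (laurentSum x π a) β e y (0 ^ (2 * k) * (deriv f s)⁻¹)).IsInvertible
  rwa [zero_pow (by omega), zero_mul]

/-- Near `Z`, points with `|x| ≤ ε` are covered by the invertible bordered systems with `s = x/ε` in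
`[-1, 1]`; all points with `|x| > ε` inherit nondegeneracy from `ω`. The statement is local in `(ε,
p)` jointly, so that compactness of `M` can make the bound on `ε` uniform. -/
theorem eventually_nondegenerate_desingularization (hx : ContMDiff 𝓘(ℝ, E) 𝓘(ℝ, ℝ) ∞ x)
    (hreg : ∀ p : M, x p = 0 → mfderiv 𝓘(ℝ, E) 𝓘(ℝ, ℝ) x p ≠ 0)
    (hk : 1 ≤ k) (hf : IsDesingularizer k f) (hΩ : Ω.IsBSymplectic)
    (hL : IsLaurentSeries Ω ι U π a β) (p : M) :
    ∀ᶠ w in 𝓝 ((0 : ℝ), p), 0 < w.1 → (|x w.2| ≤ w.1 → w.2 ∈ U) ∧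
      Nondegenerate (desingularization Ω U π a β f w.1 w.2) := by
  have hoff {ε : ℝ} (hε : 0 < ε) {q : M} (hq : ε < |x q|) :
      Nondegenerate (desingularization Ω U π a β f ε q) := by
    rw [desingularization_eq_toForm hx hk hf hL hε fun h => (hq.trans h.2).false]
    exact nondegenerate_toForm hx hreg hΩ (abs_pos.1 (hε.trans hq))
  by_cases hp : x p = 0
  · let e := chartAt E p
    have he : e ∈ atlas E M := chart_mem_atlas E p
    have hps : p ∈ e.source := mem_chart_source E p
    have hinv := eventually_isInvertible_chartBorder hx hreg hk hf hΩ hL he (e.map_source hps)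
      (by rw [e.left_inv hps, hp])
    have ht : Filter.Tendsto (fun w : ℝ × M => (e w.2, w.1)) (𝓝 ((0 : ℝ), p))
        (𝓝 (e p, (0 : ℝ))) :=
      ((e.continuousAt hps).tendsto.comp (continuousAt_snd (p := ((0 : ℝ), p))).tendsto).prodMk_nhds
        (continuousAt_fst (p := ((0 : ℝ), p))).tendsto
    have hpU : ∀ᶠ w in 𝓝 ((0 : ℝ), p), w.2 ∈ U :=
      (continuousAt_snd (p := ((0 : ℝ), p))).eventually (hL.isOpen.mem_nhds (hL.subset hp))
    have hsrc : ∀ᶠ w in 𝓝 ((0 : ℝ), p), w.2 ∈ e.source :=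
      (continuousAt_snd (p := ((0 : ℝ), p))).eventually (e.open_source.mem_nhds hps)
    filter_upwards [ht.eventually hinv, hpU, hsrc] with w h1 h2 h3 hw
    refine ⟨fun _ => h2, ?_⟩
    rcases lt_or_ge w.1 |x w.2| with h | h
    · exact hoff hw h
    · have hs : x w.2 / w.1 ∈ Set.Icc (-1 : ℝ) 1 := by
        rw [Set.mem_Icc, ← abs_le, abs_div, abs_of_pos hw]
        exact (div_le_one hw).2 h
      rw [desingularization_eq_conormalForm hx hk hf hw h2]
      obtain ⟨y, hy, hyw⟩ : ∃ y ∈ e.target, e.symm y = w.2 :=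
        ⟨e w.2, e.map_source h3, e.left_inv h3⟩
      have h1' := h1 _ hs
      rw [← hyw, e.right_inv hy] at h1'
      rw [← hyw]
      refine nondegenerate_conormalForm hx he hy
        (inv_ne_zero (invDeriv_pos hk hf hw _).ne') ?_
      rw [inv_inv]
      exact h1'
  · have h : ∀ᶠ w in 𝓝 ((0 : ℝ), p), w.1 < |x w.2| :=
      continuousAt_fst.eventually_lt (hx.continuous.continuousAt.comp continuousAt_snd).abs
        (abs_pos.2 hp)
    filter_upwards [h] with w hw hw0
    exact ⟨fun h' => absurd hw h'.not_gt, hoff hw0 hw⟩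

theorem exists_nondegenerate_desingularization [CompactSpace M]
    (hx : ContMDiff 𝓘(ℝ, E) 𝓘(ℝ, ℝ) ∞ x)
    (hreg : ∀ p : M, x p = 0 → mfderiv 𝓘(ℝ, E) 𝓘(ℝ, ℝ) x p ≠ 0)
    (hk : 1 ≤ k) (hf : IsDesingularizer k f) (hΩ : Ω.IsBSymplectic)
    (hL : IsLaurentSeries Ω ι U π a β) :
    ∃ ε₀ : ℝ, 0 < ε₀ ∧ ∀ ε : ℝ, 0 < ε → ε < ε₀ → {p | |x p| ≤ ε} ⊆ U ∧
      ∀ p, Nondegenerate (desingularization Ω U π a β f ε p) := by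
  have h := (isCompact_univ (X := M)).eventually_forall_of_forall_eventually (x₀ := (0 : ℝ))
    (P := fun ε q => 0 < ε → (|x q| ≤ ε → q ∈ U) ∧
      Nondegenerate (desingularization Ω U π a β f ε q))
    fun p _ => eventually_nondegenerate_desingularization hx hreg hk hf hΩ hL p
  obtain ⟨ε₀, hε₀, h⟩ := Metric.eventually_nhds_iff.1 h
  refine ⟨ε₀, hε₀, fun ε hε hεε₀ => ?_⟩
  have h' := h (y := ε) (by rwa [Real.dist_0_eq_abs, abs_of_pos hε])
  exact ⟨fun p hp => (h' p trivial hε).1 hp, fun p => (h' p trivial hε).2⟩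

theorem isSymplectic_desingularization (hx : ContMDiff 𝓘(ℝ, E) 𝓘(ℝ, ℝ) ∞ x)
    (hreg : ∀ p : M, x p = 0 → mfderiv 𝓘(ℝ, E) 𝓘(ℝ, ℝ) x p ≠ 0)
    (hk : 1 ≤ k) (hf : IsDesingularizer k f) (hΩ : Ω.IsBSymplectic)
    (hL : IsLaurentSeries Ω ι U π a β) {ε : ℝ} (hε : 0 < ε) (hεU : {p | |x p| ≤ ε} ⊆ U)
    (hnd : ∀ p, Nondegenerate (desingularization Ω U π a β f ε p)) :
    IsSymplectic (desingularization Ω U π a β f ε) where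
  nondegenerate := hnd
  smooth e he y hy := by
    refine ContDiffAt.contDiffWithinAt ?_
    rcases le_or_gt |x (e.symm y)| ε with h | h
    · refine ContDiffAt.congr_of_eventuallyEq ?_
        (desingularization_inChart_eventuallyEq_conormalForm hx hk hf hL.isOpen hy.1 (hεU h) hε)
      exact contDiffAt_conormalForm_inChart hx he hy.1 ((contDiff_inv_invDeriv hf ε).contDiffAt.comp y
        (contDiffAt_comp_chart_symm he hy.1 hx.contMDiffAt))
        (hL.contDiffAt_laurentSum hx he hy.1 (hεU h)) (hL.contDiffAt_beta he hy.1 (hεU h))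
    · exact ContDiffAt.congr_of_eventuallyEq
        (contDiffAt_toForm_inChart hx hΩ he hy.1 (abs_pos.1 (hε.trans h)))
        (desingularization_inChart_eventuallyEq_toForm hx hk hf hL he hy.1 hε h)
  closed e he y hy := by
    rcases le_or_gt |x (e.symm y)| ε with h | h
    · rw [extDeriv_desingularization hx hk hf hL he hy.1 (hεU h) hε]
      exact extDeriv_beta hx hreg hk hf hΩ hL he hy.1 (hεU h)
    · exact extDeriv_desingularization_of_lt_abs hx hk hf hΩ hL he hy.1 hε h

/-! ### Convergence of the dual bivector fields -/

theorem contDiffAt_coeff_desingularization (hx : ContMDiff 𝓘(ℝ, E) 𝓘(ℝ, ℝ) ∞ x)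
    (hreg : ∀ p : M, x p = 0 → mfderiv 𝓘(ℝ, E) 𝓘(ℝ, ℝ) x p ≠ 0)
    (hk : 1 ≤ k) (hf : IsDesingularizer k f) (hΩ : Ω.IsBSymplectic)
    (hL : IsLaurentSeries Ω ι U π a β) {ε : ℝ} (hε : 0 < ε) (hεU : {p | |x p| ≤ ε} ⊆ U)
    (hnd : ∀ p, Nondegenerate (desingularization Ω U π a β f ε p)) (he : e ∈ atlas E M)
    (hy : y ∈ e.target) (ξ η : Module.Dual ℝ E) :
    ContDiffAt ℝ ∞ (BivectorField.coeff
      (fun p => dualBivector (desingularization Ω U π a β f ε p)) e ξ η) y := by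
  rcases le_or_gt |x (e.symm y)| ε with h | h
  · have hμ : ContDiff ℝ ∞ (invDeriv k f ε) :=
      contDiff_const.mul ((hf.contDiff_inv_deriv hk).comp (contDiff_id.div_const ε))
    refine (contDiffAt_chartDual hx he
      (hμ.contDiffAt.comp y (contDiffAt_comp_chart_symm he hy hx.contMDiffAt)) hy
      (hL.contDiffAt_laurentSum hx he hy (hεU h)) (hL.contDiffAt_beta he hy (hεU h))
      (isInvertible_chartBorder_desingularization hx hk hf he hy (hεU h) hε (hnd _))
      ξ η).congr_of_eventuallyEq ?_
    filter_upwards [eventually_chart hL.isOpen hy (hεU h)] with z hz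
    exact coeff_dualBivector_desingularization hx hk hf he hz.1 hz.2 hε (hnd _) ξ η
  · exact (contDiffAt_coeff_poisson hx hreg hΩ he hy ξ η).congr_of_eventuallyEq
      (coeff_desingularization_eventuallyEq_poisson hx hreg hk hf hΩ hL he hy hε h ξ η)

theorem eventually_dist_iteratedFDeriv_coeff_lt (hx : ContMDiff 𝓘(ℝ, E) 𝓘(ℝ, ℝ) ∞ x)
    (hreg : ∀ p : M, x p = 0 → mfderiv 𝓘(ℝ, E) 𝓘(ℝ, ℝ) x p ≠ 0)
    (hk : 1 ≤ k) (hf : IsDesingularizer k f) (hΩ : Ω.IsBSymplectic)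
    (hL : IsLaurentSeries Ω ι U π a β)
    (hnd : ∀ᶠ ε in 𝓝[>] (0 : ℝ), ∀ p, Nondegenerate (desingularization Ω U π a β f ε p))
    (he : e ∈ atlas E M) (hy : y ∈ e.target) (ξ η : Module.Dual ℝ E) {j : ℕ} (hj : j < 2 * k)
    {δ : ℝ} (hδ : 0 < δ) :
    ∀ᶠ p : ℝ × E in 𝓝[>] (0 : ℝ) ×ˢ 𝓝 y,
      dist (iteratedFDeriv ℝ j (Ω.poisson.coeff e ξ η) p.2)
        (iteratedFDeriv ℝ j (BivectorField.coeff
          (fun q => dualBivector (desingularization Ω U π a β f p.1 q)) e ξ η) p.2) < δ := by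
  have hxe := contDiffAt_comp_chart_symm he hy hx.contMDiffAt
  have hpos : ∀ᶠ p : ℝ × E in 𝓝[>] (0 : ℝ) ×ˢ 𝓝 y, 0 < p.1 :=
    Filter.tendsto_fst.eventually (self_mem_nhdsWithin : Set.Ioi (0 : ℝ) ∈ 𝓝[>] 0)
  have htgt : ∀ᶠ p : ℝ × E in 𝓝[>] (0 : ℝ) ×ˢ 𝓝 y, p.2 ∈ e.target :=
    Filter.tendsto_snd.eventually (e.open_target.mem_nhds hy)
  let c (ε : ℝ) : E → ℝ :=
    BivectorField.coeff (fun q => dualBivector (desingularization Ω U π a β f ε q)) e ξ η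
  have hc' : ∀ᶠ p : ℝ × E in 𝓝[>] (0 : ℝ) ×ˢ 𝓝 y, p.1 < |x (e.symm p.2)| →
      c p.1 =ᶠ[𝓝 p.2] Ω.poisson.coeff e ξ η := by
    filter_upwards [hpos, htgt] with p hp ht h
    exact coeff_desingularization_eventuallyEq_poisson hx hreg hk hf hΩ hL he ht hp h ξ η
  have hc₀ := contDiffAt_coeff_poisson hx hreg hΩ he hy ξ η
  by_cases hxy : x (e.symm y) = 0
  · have hyU : e.symm y ∈ U := hL.subset hxy
    -- With `s = x/ε`, `x^{2k} - μ_ε = ε^{2k} (s^{2k} - 1/f'(s))`. Taking out `ε^{2k}` leaves a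
    -- function of `(y, ε, s)` that is smooth up to `ε = 0`.
    let Φ : (E × ℝ) × ℝ → ℝ := fun q => (q.2 ^ (2 * k) - (deriv f q.2)⁻¹) *
      chartDualSlope x (laurentSum x π a) β e ξ η q.1.1 (q.1.2 ^ (2 * k) * (deriv f q.2)⁻¹)
        (x (e.symm q.1.1) ^ (2 * k))
    have h0 := isInvertible_chartBorder_of_bform hx hreg he hy (hL.eq _ hyU) (hΩ.nondegenerate _)
    have hΦ : ∀ s ∈ Set.Icc (-1 : ℝ) 1, ContDiffAt ℝ ∞ Φ ((y, 0), s) := fun s hs => by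
      have hψ : ContDiffAt ℝ ∞ (fun q : (E × ℝ) × ℝ => (deriv f q.2)⁻¹) ((y, 0), s) :=
        ((hf.contDiff_inv_deriv hk).comp contDiff_snd).contDiffAt
      have hν : ContDiffAt ℝ ∞ (fun q : (E × ℝ) × ℝ => x (e.symm q.1.1)) ((y, 0), s) :=
        ContDiffAt.comp (g := fun z => x (e.symm z)) (f := fun q : (E × ℝ) × ℝ => q.1.1) _ hxe
          contDiff_fst.fst.contDiffAt
      have hT := (eventually_isInvertible_chartBorder hx hreg hk hf hΩ hL he hy
        hxy).self_of_nhds s hs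
      have hp : ContDiffAt ℝ ∞ (fun q : (E × ℝ) × ℝ => q.2 ^ (2 * k)) ((y, 0), s) :=
        (contDiff_snd.pow _).contDiffAt
      have hμ : ContDiffAt ℝ ∞ (fun q : (E × ℝ) × ℝ => q.1.2 ^ (2 * k) * (deriv f q.2)⁻¹)
          ((y, 0), s) := (contDiff_fst.snd.pow _).contDiffAt.mul hψ
      have hG := contDiffAt_chartDualSlope hx he (Y := fun q : (E × ℝ) × ℝ => q.1.1)
        contDiff_fst.fst.contDiffAt hμ (hν.pow (2 * k)) hy (hL.contDiffAt_laurentSum hx he hy hyU)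
        (hL.contDiffAt_beta he hy hyU) hT h0 ξ η
      exact (hp.sub hψ).mul hG
    refine eventually_norm_iteratedFDeriv_sub_lt (x := fun z => x (e.symm z)) (c := c) hxe hΦ hj hc₀ ?_
      hc' hδ
    have hU : ∀ᶠ p : ℝ × E in 𝓝[>] (0 : ℝ) ×ˢ 𝓝 y, ∀ᶠ z in 𝓝 p.2, z ∈ e.target ∧ e.symm z ∈ U :=
      Filter.tendsto_snd.eventually (eventually_chart hL.isOpen hy hyU).eventually_nhds
    -- The formula for the difference holds throughout `U`, so it gives equality on a full
    -- neighbourhood even when `|x| = ε`.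
    filter_upwards [hpos, hU, Filter.tendsto_fst.eventually hnd] with p hp hpU hpn _
    filter_upwards [hpU] with z hz
    rw [show c p.1 z = _ from
        coeff_dualBivector_desingularization hx hk hf he hz.1 hz.2 hp (hpn _) ξ η,
      coeff_poisson hx hreg he hz.1 (hL.eq _ hz.2) (hΩ.nondegenerate _),
      chartDual_eq_add (isInvertible_chartBorder_desingularization hx hk hf he hz.1 hz.2 hp (hpn _))
        (isInvertible_chartBorder_of_bform hx hreg he hz.1 (hL.eq _ hz.2) (hΩ.nondegenerate _)),
      ← mul_assoc, mul_sub, ← mul_pow, mul_div_cancel₀ _ hp.ne']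
    rfl
  · refine eventually_norm_iteratedFDeriv_sub_lt (x := fun z => x (e.symm z)) (c := c)
      (Φ := fun _ => 0) hxe (fun _ _ => contDiffAt_const) hj hc₀ ?_ hc' hδ
    have hlt : ∀ᶠ p : ℝ × E in 𝓝[>] (0 : ℝ) ×ˢ 𝓝 y, p.1 < |x (e.symm p.2)| := by
      have h : ∀ᶠ w in 𝓝 (y, (0 : ℝ)), w.2 < |x (e.symm w.1)| :=
        continuousAt_snd.eventually_lt
          (ContinuousAt.comp (f := Prod.fst) (x := (y, (0 : ℝ))) hxe.continuousAt continuousAt_fst).abs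
          (abs_pos.2 hxy)
      exact (tendsto_swap_nhdsGT y).eventually h
    filter_upwards [hlt] with p h h'
    exact absurd h h'.not_gt

end Desingularization

end BSymplectic

theorem mainTheorem1
    {E : Type*} [NormedAddCommGroup E] [NormedSpace ℝ E] [FiniteDimensional ℝ E]
    {F : Type*} [NormedAddCommGroup F] [NormedSpace ℝ F] [FiniteDimensional ℝ F]
    {M : Type*} [TopologicalSpace M] [ChartedSpace E M] [IsManifold 𝓘(ℝ, E) ∞ M]
    [T2Space M] [CompactSpace M]
    {N : Type*} [TopologicalSpace N] [ChartedSpace F N] [IsManifold 𝓘(ℝ, F) ∞ N]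
    (x : M → ℝ) (hx : ContMDiff 𝓘(ℝ, E) 𝓘(ℝ, ℝ) ∞ x)
    (hreg : ∀ p : M, x p = 0 → mfderiv 𝓘(ℝ, E) 𝓘(ℝ, ℝ) x p ≠ 0)
    (ι : N → M) (hι : Manifold.IsSmoothEmbedding 𝓘(ℝ, F) 𝓘(ℝ, E) ∞ ι)
    (hrange : Set.range ι = {p | x p = 0})
    (k : ℕ) (hk : 1 ≤ k)
    (Ω : BSymplectic.BForm E x (2 * k)) (hΩ : Ω.IsBSymplectic)
    (U : Set M) (π : M → N) (a : Fin (2 * k) → BSymplectic.DForm F N 1)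
    (β : BSymplectic.DForm E M 2)
    (hL : BSymplectic.IsLaurentSeries Ω ι U π a β)
    (f : ℝ → ℝ) (hf : BSymplectic.IsDesingularizer k f) :
    (∃ ε₀ : ℝ, 0 < ε₀ ∧ ∀ ε : ℝ, 0 < ε → ε < ε₀ →
      {p | |x p| ≤ ε} ⊆ U ∧
      BSymplectic.IsSymplectic (BSymplectic.desingularization Ω U π a β f ε)) ∧
    (∀ ε : ℝ, 0 < ε → ∀ p : M, ¬ (p ∈ U ∧ |x p| < ε) →
      BSymplectic.desingularization Ω U π a β f ε p = Ω.toForm p) ∧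
    BSymplectic.TendstoC (2 * k - 1)
      (fun ε p => BSymplectic.dualBivector (BSymplectic.desingularization Ω U π a β f ε p))
      Ω.poisson := by
  obtain ⟨ε₀, hε₀, h⟩ :=
    BSymplectic.exists_nondegenerate_desingularization hx hreg hk hf hΩ hL
  have hev : ∀ᶠ ε in 𝓝[>] (0 : ℝ), 0 < ε ∧ ε < ε₀ := Ioo_mem_nhdsGT hε₀
  refine ⟨⟨ε₀, hε₀, fun ε h1 h2 => ⟨(h ε h1 h2).1, ?_⟩⟩, fun ε hε p hp => ?_, ?_⟩
  · exact BSymplectic.isSymplectic_desingularization hx hreg hk hf hΩ hL h1 (h ε h1 h2).1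
      (h ε h1 h2).2
  · exact BSymplectic.desingularization_eq_toForm hx hk hf hL hε hp
  · refine ⟨?_, ?_, ?_⟩
    · filter_upwards [hev] with ε hε e he ξ η y hy
      exact ((BSymplectic.contDiffAt_coeff_desingularization hx hreg hk hf hΩ hL hε.1
        (h ε hε.1 hε.2).1 (h ε hε.1 hε.2).2 he hy ξ η).of_le
          (WithTop.coe_le_coe.2 le_top)).contDiffWithinAt
    · intro e he ξ η y hy
      exact ((BSymplectic.contDiffAt_coeff_poisson hx hreg hΩ he hy ξ η).of_le
        (WithTop.coe_le_coe.2 le_top)).contDiffWithinAt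
    · intro e he ξ η K hK hKc j hj
      -- On a compact set uniform convergence is local, so the estimate near a single point, uniform
      -- over `𝓝[>] 0 ×ˢ 𝓝 y`, is enough.
      refine (tendstoLocallyUniformlyOn_iff_tendstoUniformlyOn_of_compact hKc).1 ?_
      refine tendstoLocallyUniformlyOn_iff_filter.2 fun y hy => ?_
      refine Metric.tendstoUniformlyOnFilter_iff.2 fun δ hδ => ?_
      exact (BSymplectic.eventually_dist_iteratedFDeriv_coeff_lt hx hreg hk hf hΩ hL
        (hev.mono fun ε hε => (h ε hε.1 hε.2).2) he (hK hy) ξ η (by omega) hδ).filter_mono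
          (Filter.prod_mono le_rfl nhdsWithin_le_nhds)
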